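/- **Proposition 3.4 (homotopy invariance of development).** Let $G$ be a Lie group with Lie algebra $\mathfrak g = T_1G$, equipped with the bracket of right-invariant vector fields and regarded as a Lie algebroid over a point. Let $A$ be a Lie algebroid, with anchor $\#$, over a smooth manifold $\Sigma$, and let $\omega : A \to \mathfrak g$ be a Lie algebroid morphism. Write $I=[0,1]$. An *$A$-path* is a smooth map $a : I \to A$, covering a path $\gamma : I \to \Sigma$, with $\# a(t) = \dot\gamma(t)$ for all $t$. Two $A$-paths $a_0,a_1$ are *$A$-homotopic*, $a_0\sim a_1$, if their base paths have a common initial point $x$ and a common final point $y$ and there is a Lie algebroid morphism $H : T(I^2) \to A$ such that, in the coordinates $(\epsilon,t)$ of $I^2$ and for all $\tau\in I$, $$H\big(\tfrac{\partial}{\partial t}(0,\tau)\big)=a_0(\tau),\quad H\big(\tfrac{\partial}{\partial t}(1,\tau)\big)=a_1(\tau),\quad H\big(\tfrac{\partial}{\partial \epsilon}(\tau,0)\big)=0_x,\quad H\big(\tfrac{\partial}{\partial \epsilon}(\tau,1)\big)=0_y .$$ For a smooth path $\xi: I\to\mathfrak g$, a *development* of $\xi$ is a smooth map $g : I \to G$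 with $g(0)=1_G$ and $\dot g(t)\,g(t)^{-1}=\xi(t)$ for all $t$; if $g$ is the unique development of $\xi$, one writes $\int_0^1\xi := g(1)$. The set of arrows of the Weinstein groupoid $\mathcal G(A)$ is the set of $A$-paths modulo $A$-homotopy. Then: 1. For every $A$-path $a$, the path $\omega\circ a$ has exactly one development, so that $\int_0^1\omega\circ a\in G$ is defined. 2. If the $A$-paths $a_0$ and $a_1$ are $A$-homotopic, then $\int_0^1\omega\circ a_0=\int_0^1\omega\circ a_1$. 3. Consequently the invariant monodromy $\Omega:\mathcal G(A)\to G$ is well defined as a map: there is exactly one map $\Omega$ on the arrows of $\mathcal G(A)$ with $\Omega([a])=\int_0^1\omega\circ a$ for every $A$-path $a$. -/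

import Mathlib

open Bundle Manifold VectorField
open scoped ContDiff

noncomputable section

section RightInvariant

variable {E H : Type*} [NormedAddCommGroup E] [NormedSpace ℝ E] [TopologicalSpace H]
  {I : ModelWithCorners ℝ E H} {G : Type*} [TopologicalSpace G] [ChartedSpace H G] [Group G]

/-- The right-invariant vector field on a Lie group with value `v` at the identity. -/
def rightInvariantVectorField (v : GroupLieAlgebra I G) (g : G) : TangentSpace I g :=
  mfderiv I I (fun x : G => x * g) 1 v

/-- The Lie bracket on `T_1 G` obtained from right-invariant vector fields. The development below
is taken with respect to the right-invariant Maurer-Cartan form, and it is for this bracket that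
the right-invariant Maurer-Cartan form is a Lie algebroid morphism from `T G` to the Lie algebra.
(Mathlib's bracket on `GroupLieAlgebra` comes from left-invariant fields and is its negative.) -/
def rightBracket (v w : GroupLieAlgebra I G) : GroupLieAlgebra I G :=
  mlieBracket I (rightInvariantVectorField v) (rightInvariantVectorField w) 1

theorem rightBracket_swap (v w : GroupLieAlgebra I G) :
    rightBracket v w = - rightBracket w v := mlieBracket_swap_apply

variable (I G) in
/-- The derivative of inversion at the identity. -/
def invDeriv : GroupLieAlgebra I G →L[ℝ] GroupLieAlgebra I G :=
  mfderiv I I (fun x : G => x⁻¹) (1 : G)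

variable [LieGroup I ∞ G]

theorem lieGroup_three : LieGroup I (minSmoothness ℝ 3) G := by
  simp only [minSmoothness_of_isRCLikeNormedField]; infer_instance

theorem mdiff_inv (g : G) : MDifferentiableAt I I (fun x : G => x⁻¹) g :=
  (contMDiff_inv I ∞).mdifferentiable (by simp) g

theorem mdiff_mul_left (g h : G) : MDifferentiableAt I I (fun x : G => g * x) h :=
  (contMDiff_mul_left (n := ∞)).mdifferentiable (by simp) h

theorem mdiff_mul_right (g h : G) : MDifferentiableAt I I (fun x : G => x * g) h :=
  (contMDiff_mul_right (n := ∞)).mdifferentiable (by simp) h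

theorem mfderiv_inv_comp (g : G) :
    (mfderiv I I (fun x : G => x⁻¹) g⁻¹).comp (mfderiv I I (fun x : G => x⁻¹) g) =
      ContinuousLinearMap.id ℝ (TangentSpace I g) := by
  have A : mfderiv I I ((fun x : G => x⁻¹) ∘ fun x : G => x⁻¹) g =
      ContinuousLinearMap.id ℝ (TangentSpace I g) := by
    have : ((fun x : G => x⁻¹) ∘ fun x : G => x⁻¹) = id := by ext x; simp
    rw [this]; exact mfderiv_id
  rwa [mfderiv_comp (I' := I) _ (mdiff_inv _) (mdiff_inv _)] at A

theorem mfderiv_inv_inverse (g : G) :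
    (mfderiv I I (fun x : G => x⁻¹) g).inverse = mfderiv I I (fun x : G => x⁻¹) g⁻¹ := by
  refine ContinuousLinearMap.inverse_eq ?_ (mfderiv_inv_comp g)
  obtain ⟨h, rfl⟩ : ∃ h, g = h⁻¹ := ⟨g⁻¹, by simp⟩
  rw [inv_inv h]
  exact mfderiv_inv_comp h

theorem invDeriv_invDeriv (v : GroupLieAlgebra I G) : invDeriv I G (invDeriv I G v) = v := by
  have := mfderiv_inv_comp (I := I) (1 : G)
  rw [inv_one] at this
  exact DFunLike.congr_fun this v

theorem rightInvariantVectorField_eq (v : GroupLieAlgebra I G) :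
    (rightInvariantVectorField v : Π g : G, TangentSpace I g) =
      mpullback I I (fun x : G => x⁻¹) (mulInvariantVectorField (invDeriv I G v)) := by
  ext g
  have h1 : mfderiv I I ((fun x : G => x⁻¹) ∘ fun x : G => x * g) 1 =
      mfderiv I I ((fun x : G => g⁻¹ * x) ∘ fun x : G => x⁻¹) 1 := by
    congr 1; ext x; simp
  rw [mfderiv_comp (I' := I) _ (mdiff_inv _) (mdiff_mul_right _ _),
    mfderiv_comp (I' := I) _ (mdiff_mul_left _ _) (mdiff_inv _)] at h1
  rw [one_mul, inv_one] at h1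
  have k2 := DFunLike.congr_fun h1 v
  have k3 := DFunLike.congr_fun (mfderiv_inv_comp (I := I) g) (rightInvariantVectorField v g)
  rw [mpullback_apply, mfderiv_inv_inverse]
  refine k3.symm.trans ?_
  exact congrArg (mfderiv I I (fun x : G => x⁻¹) g⁻¹) k2

variable [FiniteDimensional ℝ E]

theorem rightBracket_eq (v w : GroupLieAlgebra I G) :
    rightBracket v w = invDeriv I G ⁅invDeriv I G v, invDeriv I G w⁆ := by
  have hc := FiniteDimensional.complete ℝ E
  have h3 := lieGroup_three (I := I) (G := G)
  unfold rightBracket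
  rw [rightInvariantVectorField_eq, rightInvariantVectorField_eq,
    ← mpullback_mlieBracket (n := minSmoothness ℝ 3)]
  · rw [mpullback_apply, mfderiv_inv_inverse, inv_one]
    rfl
  · exact mdifferentiableAt_mulInvariantVectorField _
  · exact mdifferentiableAt_mulInvariantVectorField _
  · exact (contMDiff_inv I _).contMDiffAt
  · exact minSmoothness_monotone (by norm_cast)

theorem rightBracket_add_left (u v w : GroupLieAlgebra I G) :
    rightBracket (u + v) w = rightBracket u w + rightBracket v w := by
  have hc := FiniteDimensional.complete ℝ E
  have h3 := lieGroup_three (I := I) (G := G)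
  simp only [rightBracket_eq, map_add, add_lie]

theorem rightBracket_smul_left (c : ℝ) (v w : GroupLieAlgebra I G) :
    rightBracket (c • v) w = c • rightBracket v w := by
  have hc := FiniteDimensional.complete ℝ E
  have h3 := lieGroup_three (I := I) (G := G)
  simp only [rightBracket_eq, map_smul, smul_lie]

theorem rightBracket_add_right (u v w : GroupLieAlgebra I G) :
    rightBracket u (v + w) = rightBracket u v + rightBracket u w := by
  rw [rightBracket_swap, rightBracket_add_left, rightBracket_swap u v, rightBracket_swap u w]
  abel

theorem rightBracket_smul_right (c : ℝ) (v w : GroupLieAlgebra I G) :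
    rightBracket v (c • w) = c • rightBracket v w := by
  rw [rightBracket_swap, rightBracket_smul_left, rightBracket_swap v w, smul_neg]

theorem rightBracket_jacobi (u v w : GroupLieAlgebra I G) :
    rightBracket u (rightBracket v w) =
      rightBracket (rightBracket u v) w + rightBracket v (rightBracket u w) := by
  have hc := FiniteDimensional.complete ℝ E
  have h3 := lieGroup_three (I := I) (G := G)
  simp only [rightBracket_eq, invDeriv_invDeriv, ← map_add]
  rw [leibniz_lie]

end RightInvariant

section Algebroid

/-- The product of a smooth function and a smooth section of a vector bundle. -/
def smulSection {E H M F : Type*} [NormedAddCommGroup E] [NormedSpace ℝ E] [TopologicalSpace H]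
    {I : ModelWithCorners ℝ E H} [TopologicalSpace M] [ChartedSpace H M]
    [NormedAddCommGroup F] [NormedSpace ℝ F]
    {A : M → Type*} [TopologicalSpace (TotalSpace F A)] [∀ x, TopologicalSpace (A x)]
    [∀ x, AddCommGroup (A x)] [∀ x, Module ℝ (A x)] [FiberBundle F A] [VectorBundle ℝ F A]
    (f : C^∞⟮I, M; ℝ⟯) (X : Cₛ^∞⟮I; F, A⟯) : Cₛ^∞⟮I; F, A⟯ :=
  ⟨fun x => f x • X x, f.contMDiff.smul_section X.contMDiff⟩

/-- A Lie algebroid structure on a smooth vector bundle `A` with model fibre `F` over a manifold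
`M` (possibly with corners): an anchor `A → TM` and a Lie bracket on the smooth sections of `A`,
satisfying the Leibniz rule. That the anchor maps brackets to brackets is included. -/
structure LieAlgebroid {E H M : Type*} [NormedAddCommGroup E] [NormedSpace ℝ E]
    [TopologicalSpace H] (I : ModelWithCorners ℝ E H) [TopologicalSpace M] [ChartedSpace H M]
    [IsManifold I ∞ M] (F : Type*) [NormedAddCommGroup F] [NormedSpace ℝ F]
    (A : M → Type*) [TopologicalSpace (TotalSpace F A)] [∀ x, TopologicalSpace (A x)]
    [∀ x, AddCommGroup (A x)] [∀ x, Module ℝ (A x)] [FiberBundle F A] [VectorBundle ℝ F A]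
    [ContMDiffVectorBundle ∞ F A I] where
  anchor : ∀ x, A x →ₗ[ℝ] TangentSpace I x
  contMDiff_anchor : ContMDiff (I.prod 𝓘(ℝ, F)) I.tangent ∞
    (fun p : TotalSpace F A => (⟨p.proj, anchor p.proj p.snd⟩ : TangentBundle I M))
  bracket : Cₛ^∞⟮I; F, A⟯ →ₗ[ℝ] Cₛ^∞⟮I; F, A⟯ →ₗ[ℝ] Cₛ^∞⟮I; F, A⟯
  bracket_self : ∀ X, bracket X X = 0
  jacobi : ∀ X Y Z, bracket X (bracket Y Z) = bracket (bracket X Y) Z + bracket Y (bracket X Z)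
  leibniz : ∀ (X Y : Cₛ^∞⟮I; F, A⟯) (f : C^∞⟮I, M; ℝ⟯) (x : M),
    bracket X (smulSection f Y) x =
      f x • bracket X Y x + mvfderiv I f x (anchor x (X x)) • Y x
  anchor_bracket : ∀ (X Y : Cₛ^∞⟮I; F, A⟯) (x : M),
    anchor x (bracket X Y x) =
      mlieBracket I (fun y => anchor y (X y)) (fun y => anchor y (Y y)) x

/-- The tangent bundle as a Lie algebroid: the anchor is the identity and the bracket is the Lie
bracket of vector fields. -/
def tangentLieAlgebroid {E H : Type*} [NormedAddCommGroup E] [NormedSpace ℝ E]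
    [FiniteDimensional ℝ E] [TopologicalSpace H] (I : ModelWithCorners ℝ E H)
    (M : Type*) [TopologicalSpace M] [ChartedSpace H M] [IsManifold I ∞ M] :
    LieAlgebroid I E (TangentSpace I : M → Type _) :=
  have hc : CompleteSpace E := FiniteDimensional.complete ℝ E
  have h2 : IsManifold I (minSmoothness ℝ 2) M := by
    simp only [minSmoothness_of_isRCLikeNormedField]; infer_instance
  have h3 : IsManifold I (minSmoothness ℝ 3) M := by
    simp only [minSmoothness_of_isRCLikeNormedField]; infer_instance
  have h1 : IsManifold I (((⊤ : ℕ∞) : WithTop ℕ∞) + 1) M := inferInstanceAs (IsManifold I ∞ M)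
  have hle : minSmoothness ℝ 2 ≤ ∞ := by
    rw [minSmoothness_of_isRCLikeNormedField]; exact ENat.LEInfty.out
  { anchor := fun _ => LinearMap.id
    contMDiff_anchor := contMDiff_id
    bracket := LinearMap.mk₂ ℝ
      (fun X Y => ⟨mlieBracket I X Y, ContDiff.mlieBracket_vectorField (m := ⊤) (n := ⊤)
        X.contMDiff Y.contMDiff (by simp)⟩)
      (fun X X' Y => by
        ext x; exact mlieBracket_add_left X.mdifferentiableAt X'.mdifferentiableAt)
      (fun c X Y => by ext x; exact mlieBracket_const_smul_left X.mdifferentiableAt)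
      (fun X Y Y' => by
        ext x; exact mlieBracket_add_right Y.mdifferentiableAt Y'.mdifferentiableAt)
      (fun c X Y => by ext x; exact mlieBracket_const_smul_right Y.mdifferentiableAt)
    bracket_self := fun X => by ext x; exact congrFun mlieBracket_self x
    jacobi := fun X Y Z => by
      ext x
      exact leibniz_identity_mlieBracket_apply (X.contMDiff.of_le hle x)
        (Y.contMDiff.of_le hle x) (Z.contMDiff.of_le hle x)
    leibniz := fun X Y f x => by
      have := mlieBracket_smul_right (I := I) (V := X) (f.contMDiff.mdifferentiable (by simp) x)
        (Y.mdifferentiableAt (x := x))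
      exact this.trans (add_comm _ _)
    anchor_bracket := fun X Y x => rfl }

theorem tangentBundle_unit_eq (p q : TangentBundle 𝓘(ℝ, Unit) Unit) : p = q := by
  obtain ⟨_, _⟩ := p
  obtain ⟨_, _⟩ := q
  rfl

/-- The Lie algebra `T_1 G` of a Lie group (with the bracket of right-invariant vector fields) as a
Lie algebroid over a one-point manifold. -/
def lieGroupLieAlgebroid {E H : Type*} [NormedAddCommGroup E] [NormedSpace ℝ E] [FiniteDimensional ℝ E]
    [TopologicalSpace H] (I : ModelWithCorners ℝ E H)
    (G : Type*) [TopologicalSpace G] [ChartedSpace H G] [Group G] [LieGroup I ∞ G] :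
    LieAlgebroid 𝓘(ℝ, Unit) E (Trivial Unit E) where
  anchor x := 0
  contMDiff_anchor := by
    have : Subsingleton (TangentBundle 𝓘(ℝ, Unit) Unit) := ⟨tangentBundle_unit_eq⟩
    exact contMDiff_of_subsingleton
  bracket := LinearMap.mk₂ ℝ
    (fun X Y => ⟨fun u => (rightBracket (X u : GroupLieAlgebra I G) (Y u : GroupLieAlgebra I G) : E),
       contMDiff_of_discreteTopology⟩)
    (fun X X' Y => by ext u; exact rightBracket_add_left (I := I) (G := G) _ _ _)
    (fun c X Y => by ext u; exact rightBracket_smul_left (I := I) (G := G) _ _ _)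
    (fun X Y Y' => by ext u; exact rightBracket_add_right (I := I) (G := G) _ _ _)
    (fun c X Y => by ext u; exact rightBracket_smul_right (I := I) (G := G) _ _ _)
  bracket_self X := by
    ext u
    exact congrFun (mlieBracket_self (I := I)) (1 : G)
  jacobi X Y Z := by ext u; exact rightBracket_jacobi (I := I) (G := G) _ _ _
  leibniz X Y f x := by
    have h : mvfderiv 𝓘(ℝ, Unit) f x ((0 : E →ₗ[ℝ] TangentSpace 𝓘(ℝ, Unit) x) (X x)) = 0 :=
      map_zero (mvfderiv 𝓘(ℝ, Unit) f x)
    have h' : ∀ (r : ℝ) (y z : E), r = 0 → z = z + r • y := by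
      rintro r y z rfl
      simp
    exact (rightBracket_smul_right (I := I) (G := G) (f x) (X x) (Y x)).trans (h' _ (Y x) _ h)
  anchor_bracket X Y x := rfl

variable {E H M F : Type*} [NormedAddCommGroup E] [NormedSpace ℝ E] [TopologicalSpace H]
  {I : ModelWithCorners ℝ E H} [TopologicalSpace M] [ChartedSpace H M] [IsManifold I ∞ M]
  [NormedAddCommGroup F] [NormedSpace ℝ F]
  {A : M → Type*} [TopologicalSpace (TotalSpace F A)] [∀ x, TopologicalSpace (A x)]
  [∀ x, AddCommGroup (A x)] [∀ x, Module ℝ (A x)] [FiberBundle F A] [VectorBundle ℝ F A]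
  [ContMDiffVectorBundle ∞ F A I]

/-- The Lie algebroid differential of an `A`-one-form `α` (a section of the dual of `A`):
`dα(X, Y) = #X(α(Y)) - #Y(α(X)) - α([X, Y])`. -/
def LieAlgebroid.d (𝓐 : LieAlgebroid I F A) (α : ∀ x, A x →ₗ[ℝ] ℝ)
    (X Y : Cₛ^∞⟮I; F, A⟯) (x : M) : ℝ :=
  mvfderiv I (fun y => α y (Y y)) x (𝓐.anchor x (X x))
    - mvfderiv I (fun y => α y (X y)) x (𝓐.anchor x (Y x))
    - α x (𝓐.bracket X Y x)

variable {E' H' N F' : Type*} [NormedAddCommGroup E'] [NormedSpace ℝ E'] [TopologicalSpace H']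
  {J : ModelWithCorners ℝ E' H'} [TopologicalSpace N] [ChartedSpace H' N] [IsManifold J ∞ N]
  [NormedAddCommGroup F'] [NormedSpace ℝ F']
  {B : N → Type*} [TopologicalSpace (TotalSpace F' B)] [∀ x, TopologicalSpace (B x)]
  [∀ x, AddCommGroup (B x)] [∀ x, Module ℝ (B x)] [FiberBundle F' B] [VectorBundle ℝ F' B]
  [ContMDiffVectorBundle ∞ F' B J]

/-- A morphism of Lie algebroids `A → B` over possibly different bases: a smooth vector bundle
map such that pulling back forms commutes with the Lie algebroid differentials. On functions this
is compatibility with the anchors (`anchor_comm`); on one-forms it is `d_comm`, where `β` is a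
smooth one-form on `B` and `Y`, `Y'` are any sections of `B` extending the images at `x` of the
values of the sections `X`, `X'` of `A`. -/
structure LieAlgebroidMorphism (𝓐 : LieAlgebroid I F A) (𝓑 : LieAlgebroid J F' B) where
  base : M → N
  contMDiff_base : ContMDiff I J ∞ base
  toFun : ∀ x, A x →ₗ[ℝ] B (base x)
  contMDiff_toFun : ContMDiff (I.prod 𝓘(ℝ, F)) (J.prod 𝓘(ℝ, F')) ∞
    (fun p : TotalSpace F A => (⟨base p.proj, toFun p.proj p.snd⟩ : TotalSpace F' B))
  anchor_comm : ∀ (x : M) (v : A x),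
    𝓑.anchor (base x) (toFun x v) = mfderiv I J base x (𝓐.anchor x v)
  d_comm : ∀ β : ∀ y, B y →ₗ[ℝ] ℝ,
    ContMDiff (J.prod 𝓘(ℝ, F')) 𝓘(ℝ, ℝ) ∞ (fun q : TotalSpace F' B => β q.proj q.snd) →
    ∀ (x : M) (X X' : Cₛ^∞⟮I; F, A⟯) (Y Y' : Cₛ^∞⟮J; F', B⟯),
      Y (base x) = toFun x (X x) → Y' (base x) = toFun x (X' x) →
      𝓐.d (fun z => β (base z) ∘ₗ toFun z) X X' x = 𝓑.d β Y Y' (base x)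

/-- The map of total spaces underlying a Lie algebroid morphism. -/
def LieAlgebroidMorphism.map {𝓐 : LieAlgebroid I F A} {𝓑 : LieAlgebroid J F' B}
    (Φ : LieAlgebroidMorphism 𝓐 𝓑) (p : TotalSpace F A) : TotalSpace F' B :=
  ⟨Φ.base p.proj, Φ.toFun p.proj p.snd⟩

/-- An `A`-path: a smooth map `a : [0, 1] → A` whose anchor is the velocity of its base path. -/
structure APath (𝓐 : LieAlgebroid I F A) where
  toFun : unitInterval → TotalSpace F A
  contMDiff_toFun : ContMDiff (𝓡∂ 1) (I.prod 𝓘(ℝ, F)) ∞ toFun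
  anchor_eq : ∀ t : unitInterval, 𝓐.anchor (toFun t).proj (toFun t).snd =
    mfderiv (𝓡∂ 1) I (fun s => (toFun s).proj) t 1

/-- Coordinates on the square are written `(ε, t)`. This is the vector `∂/∂t` at `(ε, t)`, the
velocity of the inclusion `s ↦ (ε, s)`. -/
def squareDt (ε t : unitInterval) :
    TangentBundle ((𝓡∂ 1).prod (𝓡∂ 1)) (unitInterval × unitInterval) :=
  tangentMap (𝓡∂ 1) ((𝓡∂ 1).prod (𝓡∂ 1)) (fun s : unitInterval => (ε, s)) ⟨t, 1⟩

/-- The vector `∂/∂ε` at `(ε, t)`, the velocity of the inclusion `s ↦ (s, t)`. -/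
def squareDeps (ε t : unitInterval) :
    TangentBundle ((𝓡∂ 1).prod (𝓡∂ 1)) (unitInterval × unitInterval) :=
  tangentMap (𝓡∂ 1) ((𝓡∂ 1).prod (𝓡∂ 1)) (fun s : unitInterval => (s, t)) ⟨ε, 1⟩

/-- `A`-homotopy of `A`-paths: their base paths run from a common point `x` to a common point `y`,
and some Lie algebroid morphism from the tangent bundle of the unit square to `A` restricts to `a₀`
and `a₁` on the edges `ε = 0` and `ε = 1`, and to the zero paths over `x` and `y` on the edges
`t = 0` and `t = 1`. -/
def APath.Homotopic {𝓐 : LieAlgebroid I F A} (a₀ a₁ : APath 𝓐) : Prop :=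
  ∃ x y : M,
    (a₀.toFun 0).proj = x ∧ (a₁.toFun 0).proj = x ∧
    (a₀.toFun 1).proj = y ∧ (a₁.toFun 1).proj = y ∧
    ∃ Φ : LieAlgebroidMorphism
        (tangentLieAlgebroid ((𝓡∂ 1).prod (𝓡∂ 1)) (unitInterval × unitInterval)) 𝓐,
      (∀ τ, Φ.map (squareDt 0 τ) = a₀.toFun τ) ∧
      (∀ τ, Φ.map (squareDt 1 τ) = a₁.toFun τ) ∧
      (∀ τ, Φ.map (squareDeps τ 0) = ⟨x, 0⟩) ∧
      (∀ τ, Φ.map (squareDeps τ 1) = ⟨y, 0⟩)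

/-- The Weinstein groupoid (as the set of its arrows): `A`-paths modulo `A`-homotopy. -/
def WeinsteinGroupoid (𝓐 : LieAlgebroid I F A) : Type _ :=
  Quot (APath.Homotopic (𝓐 := 𝓐))

/-- The arrow of the Weinstein groupoid represented by an `A`-path. -/
def WeinsteinGroupoid.mk {𝓐 : LieAlgebroid I F A} (a : APath 𝓐) : WeinsteinGroupoid 𝓐 :=
  Quot.mk _ a

end Algebroid

section Development

/-- `g` is the development of the path `ξ` in the Lie algebra of `G`: the smooth path in `G`
starting at the identity with logarithmic derivative `ξ`, that is `ġ(t) g(t)⁻¹ = ξ(t)`. Its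
end point `g 1` is the integral `∫₀¹ ξ`. -/
def IsDevelopment {E H G : Type*} [NormedAddCommGroup E] [NormedSpace ℝ E] [TopologicalSpace H]
    {J : ModelWithCorners ℝ E H} [TopologicalSpace G] [ChartedSpace H G] [Group G]
    (ξ : unitInterval → GroupLieAlgebra J G) (g : unitInterval → G) : Prop :=
  ContMDiff (𝓡∂ 1) J ∞ g ∧ g 0 = 1 ∧
    ∀ t : unitInterval, mfderiv (𝓡∂ 1) J g t 1 = rightInvariantVectorField (ξ t) (g t)

/-- The composite `η ∘ a` of an `A`-path with a Lie algebroid morphism from `A` to the Lie algebra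
of `G`. -/
def LieAlgebroidMorphism.compPath {E H M F : Type*} [NormedAddCommGroup E] [NormedSpace ℝ E]
    [TopologicalSpace H] {I : ModelWithCorners ℝ E H} [TopologicalSpace M] [ChartedSpace H M]
    [IsManifold I ∞ M] [NormedAddCommGroup F] [NormedSpace ℝ F]
    {A : M → Type*} [TopologicalSpace (TotalSpace F A)] [∀ x, TopologicalSpace (A x)]
    [∀ x, AddCommGroup (A x)] [∀ x, Module ℝ (A x)] [FiberBundle F A] [VectorBundle ℝ F A]
    [ContMDiffVectorBundle ∞ F A I] {𝓐 : LieAlgebroid I F A}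
    {E' H' G : Type*} [NormedAddCommGroup E'] [NormedSpace ℝ E'] [FiniteDimensional ℝ E']
    [TopologicalSpace H'] {J : ModelWithCorners ℝ E' H'} [TopologicalSpace G] [ChartedSpace H' G]
    [Group G] [LieGroup J ∞ G]
    (η : LieAlgebroidMorphism 𝓐 (lieGroupLieAlgebroid J G)) (a : APath 𝓐) :
    unitInterval → GroupLieAlgebra J G :=
  fun t => (η.map (a.toFun t)).snd

end Development

end

noncomputable section

section Analysis

open Set Metric Filter Topology NNReal

variable {V W : Type*} [NormedAddCommGroup V] [NormedSpace ℝ V]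
  [NormedAddCommGroup W] [NormedSpace ℝ W]

theorem ContDiffOn.exists_lipschitzOnWith_of_isCompact {f : V → W} {K : Set V}
    (hf : ContDiffOn ℝ 1 f K) (hK : IsCompact K) (hc : Convex ℝ K) :
    ∃ C : ℝ≥0, LipschitzOnWith C f K := by
  refine LocallyLipschitzOn.exists_lipschitzOnWith_of_compact hK fun x hx => ?_
  obtain ⟨C, t, ht, h⟩ := (hf x hx).exists_lipschitzOnWith hc
  exact ⟨C, t, ht, h⟩

/-- First order Taylor estimate, uniform on a compact convex set. -/
theorem ContDiffOn.exists_norm_sub_fderivWithin_le {f : V → W} {K : Set V}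
    (hf : ContDiffOn ℝ 2 f K) (hK : IsCompact K) (hc : Convex ℝ K) (hu : UniqueDiffOn ℝ K) :
    ∃ C : ℝ, 0 ≤ C ∧ ∀ x ∈ K, ∀ y ∈ K,
      ‖f y - f x - fderivWithin ℝ f K x (y - x)‖ ≤ C * ‖y - x‖ ^ 2 := by
  obtain ⟨C, hC⟩ := (hf.fderivWithin hu (m := 1) (by norm_num)).exists_lipschitzOnWith_of_isCompact
    hK hc
  refine ⟨C, C.2, fun x hx y hy => ?_⟩
  have hs : segment ℝ x y ⊆ K := hc.segment_subset hx hy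
  have key := Convex.norm_image_sub_le_of_norm_hasFDerivWithin_le' (f := f)
    (f' := fderivWithin ℝ f K) (φ := fderivWithin ℝ f K x) (C := C * ‖y - x‖)
    (s := segment ℝ x y) (x := x) (y := y)
    (fun z hz => ((hf.differentiableOn (by norm_num) z (hs hz)).hasFDerivWithinAt).mono hs)
    (fun z hz => ?_) (convex_segment x y) (left_mem_segment ℝ x y) (right_mem_segment ℝ x y)
  · linarith [key, sq ‖y - x‖]
  · rw [← dist_eq_norm]
    refine (hC.dist_le_mul _ (hs hz) _ hx).trans ?_
    gcongr
    obtain ⟨a, b, ha, hb, hab, rfl⟩ := hz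
    rw [dist_eq_norm]
    have : a • x + b • y - x = b • (y - x) := by
      rw [← eq_sub_iff_add_eq] at hab
      subst hab; module
    rw [this, norm_smul, Real.norm_of_nonneg hb]
    exact mul_le_of_le_one_left (norm_nonneg _) (by linarith)

theorem gronwallBound_eq_linear (δ K ε x : ℝ) :
    gronwallBound δ K ε x = δ * gronwallBound 1 K 0 x + ε * gronwallBound 0 K 1 x := by
  unfold gronwallBound
  split_ifs <;> ring

variable (Φ : V → V →ₗ[ℝ] V) {T : Set V}

/-- Uniform time of existence for the time-dependent equation `x' = Φ x (ξ t)`. -/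
theorem exists_uniform_solution [FiniteDimensional ℝ V]
    (hT : IsOpen T) (hΦ : ContDiffOn ℝ ∞ (fun p : V × V => Φ p.1 p.2) (T ×ˢ univ))
    {x₀ : V} (hx₀ : x₀ ∈ T) (U : ℝ) :
    ∃ R r τ : ℝ, 0 < R ∧ 0 < r ∧ 0 < τ ∧ closedBall x₀ (2 * R) ⊆ T ∧
      ∀ (t₀ t₁ : ℝ) (ξ : ℝ → V), t₀ ≤ t₁ → t₁ - t₀ ≤ τ → ContinuousOn ξ (Icc t₀ t₁) →
        (∀ t ∈ Icc t₀ t₁, ‖ξ t‖ ≤ U) → ∀ x ∈ closedBall x₀ r, ∃ α : ℝ → V, α t₀ = x ∧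
          ∀ t ∈ Icc t₀ t₁, α t ∈ closedBall x₀ R ∧
            HasDerivWithinAt α (Φ (α t) (ξ t)) (Icc t₀ t₁) t := by
  have hcV := FiniteDimensional.complete ℝ V
  obtain ⟨R', hR', hRT⟩ := Metric.nhds_basis_closedBall.mem_iff.1 (hT.mem_nhds hx₀)
  set R := R' / 2 with hR
  have hRpos : 0 < R := by positivity
  have h2R : closedBall x₀ (2 * R) ⊆ T := by
    rwa [hR, mul_div_cancel₀ _ two_ne_zero]
  have hRsub : closedBall x₀ R ⊆ T :=
    (closedBall_subset_closedBall (by linarith)).trans h2R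
  have hcomp : IsCompact (closedBall x₀ R ×ˢ closedBall (0 : V) U) :=
    (isCompact_closedBall _ _).prod (isCompact_closedBall _ _)
  have hsub : closedBall x₀ R ×ˢ closedBall (0 : V) U ⊆ T ×ˢ univ :=
    prod_mono hRsub (subset_univ _)
  obtain ⟨K, hK⟩ := ((hΦ.mono hsub).of_le (by simp)).exists_lipschitzOnWith_of_isCompact hcomp
    ((convex_closedBall _ _).prod (convex_closedBall _ _))
  obtain ⟨L', hL'⟩ := hcomp.exists_bound_of_continuousOn (hΦ.mono hsub).continuousOn
  set L : ℝ≥0 := ⟨max L' 0 + 1, by positivity⟩ with hL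
  have hLpos : (0 : ℝ) < L := by change (0 : ℝ) < max L' 0 + 1; positivity
  have hL'L : L' ≤ L := by
    change L' ≤ max L' 0 + 1
    linarith [le_max_left L' 0]
  refine ⟨R, R / 2, R / 2 / L, hRpos, by positivity, by positivity, h2R,
    fun t₀ t₁ ξ h01 hτ hξ hξU x hx => ?_⟩
  have hmem : ∀ t ∈ Icc t₀ t₁, ξ t ∈ closedBall (0 : V) U := fun t ht => by
    simpa using hξU t ht
  have hPL : IsPicardLindelof (fun t y => Φ y (ξ t)) (tmin := t₀) (tmax := t₁)
      ⟨t₀, left_mem_Icc.2 h01⟩ x₀ ⟨R, hRpos.le⟩ ⟨R / 2, by positivity⟩ L K := by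
    refine ⟨fun t ht => ?_, fun y hy => ?_, fun t ht y hy => ?_, ?_⟩
    · refine LipschitzOnWith.of_dist_le_mul fun y hy z hz => ?_
      refine (hK.dist_le_mul (y, ξ t) ⟨hy, hmem t ht⟩ (z, ξ t) ⟨hz, hmem t ht⟩).trans ?_
      simp [Prod.dist_eq]
    · exact hΦ.continuousOn.comp (continuousOn_const.prodMk hξ)
        fun t ht => ⟨hRsub hy, mem_univ _⟩
    · exact (hL' (y, ξ t) ⟨hy, hmem t ht⟩).trans hL'L
    · change (L : ℝ) * max (t₁ - t₀) (t₀ - t₀) ≤ R - R / 2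
      rw [sub_self, max_eq_left (by linarith)]
      calc (L : ℝ) * (t₁ - t₀) ≤ L * (R / 2 / L) := by gcongr
        _ = R - R / 2 := by field_simp; ring
  obtain ⟨α, hα⟩ := ODE.FunSpace.exists_isFixedPt_next hPL (x := x) hx
  refine ⟨α.compProj, ?_, fun t ht =>
    ⟨ODE.FunSpace.compProj_mem_closedBall α hPL.mul_max_le, ?_⟩⟩
  · have h0 := ODE.FunSpace.next_apply₀ hPL hx α
    rw [hα] at h0
    exact (ODE.FunSpace.compProj_of_mem (left_mem_Icc.2 h01)).trans h0
  · have heq : EqOn α.compProj (ODE.picard (fun t y => Φ y (ξ t)) t₀ x α.compProj)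
        (Icc t₀ t₁) := fun s hs =>
      (ODE.FunSpace.compProj_of_mem hs).trans
        ((ODE.FunSpace.isFixedPt_next_iff hPL hx).1 hα ⟨s, hs⟩)
    exact (ODE.hasDerivWithinAt_picard_Icc (left_mem_Icc.2 h01) hPL.continuousOn_uncurry
      α.continuous_compProj.continuousOn
      (fun s _ => ODE.FunSpace.compProj_mem_closedBall α hPL.mul_max_le) x ht).congr heq (heq ht)

end Analysis

section Propagation

open Set Metric Filter Topology NNReal

variable {V : Type*} [NormedAddCommGroup V] [NormedSpace ℝ V]
  {Φ : V → V →ₗ[ℝ] V} {T : Set V}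

theorem differentiableAt_uncurry_of_mem (hT : IsOpen T)
    (hΦ : ContDiffOn ℝ ∞ (fun p : V × V => Φ p.1 p.2) (T ×ˢ univ)) {x : V} (hx : x ∈ T) (v : V) :
    DifferentiableAt ℝ (fun p : V × V => Φ p.1 p.2) (x, v) :=
  (hΦ.differentiableOn (by simp)).differentiableAt
    ((hT.prod isOpen_univ).mem_nhds ⟨hx, mem_univ _⟩)

theorem fderiv_uncurry_inr [FiniteDimensional ℝ V] (hT : IsOpen T)
    (hΦ : ContDiffOn ℝ ∞ (fun p : V × V => Φ p.1 p.2) (T ×ˢ univ)) {x : V} (hx : x ∈ T) (v k : V) :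
    fderiv ℝ (fun p : V × V => Φ p.1 p.2) (x, v) (0, k) = Φ x k := by
  have h1 : HasFDerivAt (fun w : V => (x, w)) (ContinuousLinearMap.inr ℝ V V) v :=
    hasFDerivAt_prodMk_right x v
  have h2 := (differentiableAt_uncurry_of_mem hT hΦ hx v).hasFDerivAt.comp v h1
  have h3 : HasFDerivAt (fun w : V => Φ x w) (Φ x).toContinuousLinearMap v :=
    (Φ x).toContinuousLinearMap.hasFDerivAt
  exact DFunLike.congr_fun (h2.unique h3) k

/-- The closed unit square. -/
def unitSquare : Set (ℝ × ℝ) := Icc 0 1 ×ˢ Icc 0 1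

theorem isCompact_unitSquare : IsCompact unitSquare := isCompact_Icc.prod isCompact_Icc

theorem convex_unitSquare : Convex ℝ unitSquare := (convex_Icc _ _).prod (convex_Icc _ _)

theorem uniqueDiffOn_unitSquare : UniqueDiffOn ℝ unitSquare :=
  (uniqueDiffOn_Icc zero_lt_one).prod (uniqueDiffOn_Icc zero_lt_one)

/-- The Maurer-Cartan identity for the bundle map `Φ`, with respect to a bracket `b`. -/
def MaurerCartanOn (Φ : V → V →ₗ[ℝ] V) (T : Set V) (b : V → V → V) : Prop :=
  ∀ x ∈ T, ∀ u v : V,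
    fderiv ℝ (fun p : V × V => Φ p.1 p.2) (x, v) (Φ x u, 0) -
      fderiv ℝ (fun p : V × V => Φ p.1 p.2) (x, u) (Φ x v, 0) = Φ x (b u v)

/-- The `V`-valued one-form `v dε + u dt` on the unit square is flat with respect to the
bracket `b`. -/
def FlatOnSquare (b : V → V → V) (u v : ℝ × ℝ → V) : Prop :=
  ∀ p ∈ unitSquare,
    fderivWithin ℝ v unitSquare p (0, 1) - fderivWithin ℝ u unitSquare p (1, 0) = - b (u p) (v p)

theorem hasDerivWithinAt_slice {v : ℝ × ℝ → V} (hv : ContDiffOn ℝ ∞ v unitSquare)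
    {ε t t₀ t₁ : ℝ} (hε : ε ∈ Icc (0 : ℝ) 1) (hs : Icc t₀ t₁ ⊆ Icc 0 1) (ht : t ∈ Icc t₀ t₁) :
    HasDerivWithinAt (fun s => v (ε, s)) (fderivWithin ℝ v unitSquare (ε, t) (0, 1))
      (Icc t₀ t₁) t := by
  have h1 : HasFDerivWithinAt v (fderivWithin ℝ v unitSquare (ε, t)) unitSquare (ε, t) :=
    (hv.differentiableOn (by simp) (ε, t) ⟨hε, hs ht⟩).hasFDerivWithinAt
  have h2 : HasDerivWithinAt (fun s : ℝ => (ε, s)) ((0 : ℝ), (1 : ℝ)) (Icc t₀ t₁) t :=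
    (hasDerivWithinAt_const _ _ _).prodMk (hasDerivWithinAt_id _ _)
  exact h1.comp_hasDerivWithinAt t h2 fun s hs' => ⟨hε, hs hs'⟩

variable [FiniteDimensional ℝ V] {b : V → V → V} {u v : ℝ × ℝ → V}

/-- Displacing a solution `X` of `x' = Φ x (u (ε₀, t))` by `(ε - ε₀) Φ X v` gives, up to second
order, a solution of `x' = Φ x (u (ε, t))`. -/
theorem exists_defect_bound (hT : IsOpen T)
    (hΦ : ContDiffOn ℝ ∞ (fun p : V × V => Φ p.1 p.2) (T ×ˢ univ))
    (hMC : MaurerCartanOn Φ T b) (hu : ContDiffOn ℝ ∞ u unitSquare)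
    (hv : ContDiffOn ℝ ∞ v unitSquare) (hflat : FlatOnSquare b u v)
    {x₀ : V} {R : ℝ} (hR : 0 < R) (hRT : closedBall x₀ (2 * R) ⊆ T)
    {ε₀ t₀ t₁ : ℝ} (hε₀ : ε₀ ∈ Icc (0 : ℝ) 1) (hs : Icc t₀ t₁ ⊆ Icc 0 1) {X : ℝ → V}
    (hXR : ∀ t ∈ Icc t₀ t₁, X t ∈ closedBall x₀ R)
    (hX : ∀ t ∈ Icc t₀ t₁, HasDerivWithinAt X (Φ (X t) (u (ε₀, t))) (Icc t₀ t₁) t) :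
    ∃ C δ : ℝ, 0 ≤ C ∧ 0 < δ ∧ ∀ ε ∈ Icc (0 : ℝ) 1, |ε - ε₀| ≤ δ → ∀ t ∈ Icc t₀ t₁,
      X t + (ε - ε₀) • Φ (X t) (v (ε₀, t)) ∈ closedBall x₀ (2 * R) ∧
      ∃ y' : V, HasDerivWithinAt (fun t => X t + (ε - ε₀) • Φ (X t) (v (ε₀, t))) y'
          (Icc t₀ t₁) t ∧
        ‖y' - Φ (X t + (ε - ε₀) • Φ (X t) (v (ε₀, t))) (u (ε, t))‖ ≤ C * (ε - ε₀) ^ 2 := by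
  have hRT' : closedBall x₀ R ⊆ T := (closedBall_subset_closedBall (by linarith)).trans hRT
  have hXT : ∀ t ∈ Icc t₀ t₁, X t ∈ T := fun t ht => hRT' (hXR t ht)
  have hXc : ContinuousOn X (Icc t₀ t₁) := fun t ht => (hX t ht).continuousWithinAt
  set Ψ : V × V → V := fun p => Φ p.1 p.2 with hΨ
  obtain ⟨U, hU⟩ := isCompact_unitSquare.exists_bound_of_continuousOn hu.continuousOn
  have hwc : ContinuousOn (fun t => Φ (X t) (v (ε₀, t))) (Icc t₀ t₁) :=
    hΦ.continuousOn.comp (hXc.prodMk fun t ht =>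
      (hasDerivWithinAt_slice hv hε₀ hs ht).continuousWithinAt) fun t ht => ⟨hXT t ht, mem_univ _⟩
  obtain ⟨W, hW⟩ := isCompact_Icc.exists_bound_of_continuousOn hwc
  set K : Set (V × V) := closedBall x₀ (2 * R) ×ˢ closedBall 0 (max U 1) with hK
  have hUpos : 0 < max U 1 := by positivity
  have hKc : IsCompact K := (isCompact_closedBall _ _).prod (isCompact_closedBall _ _)
  have hKconv : Convex ℝ K := (convex_closedBall _ _).prod (convex_closedBall _ _)
  have hKu : UniqueDiffOn ℝ K := by
    refine (uniqueDiffOn_convex (convex_closedBall _ _) ?_).prod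
      (uniqueDiffOn_convex (convex_closedBall _ _) ?_)
    · exact ⟨x₀, ball_subset_interior_closedBall (mem_ball_self (by positivity))⟩
    · exact ⟨0, ball_subset_interior_closedBall (mem_ball_self hUpos)⟩
  have hKT : K ⊆ T ×ˢ univ := prod_mono hRT (subset_univ _)
  obtain ⟨C₁, hC₁, hTay⟩ := ((hΦ.mono hKT).of_le ENat.LEInfty.out :
    ContDiffOn ℝ 2 Ψ K).exists_norm_sub_fderivWithin_le hKc hKconv hKu
  obtain ⟨C₂, hC₂, hTayu⟩ := (hu.of_le ENat.LEInfty.out :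
    ContDiffOn ℝ 2 u unitSquare).exists_norm_sub_fderivWithin_le isCompact_unitSquare
      convex_unitSquare uniqueDiffOn_unitSquare
  obtain ⟨Lu, hLu⟩ := (hu.of_le (by simp)).exists_lipschitzOnWith_of_isCompact
    isCompact_unitSquare convex_unitSquare
  have hfd : ContinuousOn (fun x : V => fderiv ℝ Ψ (x, 0)) (closedBall x₀ R) := by
    refine (hΦ.continuousOn_fderiv_of_isOpen (hT.prod isOpen_univ) (by simp)).comp
      (continuousOn_id.prodMk continuousOn_const) fun x hx => ⟨hRT' hx, mem_univ _⟩
  obtain ⟨M, hM⟩ := (isCompact_closedBall x₀ R).exists_bound_of_continuousOn hfd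
  have hΦM : ∀ x ∈ closedBall x₀ R, ∀ k, ‖Φ x k‖ ≤ M * ‖k‖ := fun x hx k => by
    rw [← fderiv_uncurry_inr hT hΦ (hRT' hx) 0 k]
    refine (ContinuousLinearMap.le_opNorm _ _).trans ?_
    have : ‖((0 : V), k)‖ = ‖k‖ := by simp [Prod.norm_def]
    rw [this]
    gcongr
    exact hM x hx
  have hM0 : 0 ≤ M := (norm_nonneg _).trans (hM x₀ (mem_closedBall_self hR.le))
  set N : ℝ := max (max W Lu) 0 with hN
  refine ⟨C₁ * N ^ 2 + M * C₂, R / (max W 0 + 1), by positivity, by positivity,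
    fun ε hε hδ t ht => ?_⟩
  set d := ε - ε₀ with hd
  set w := Φ (X t) (v (ε₀, t)) with hw
  have hWt : ‖w‖ ≤ max W 0 := (hW t ht).trans (le_max_left _ _)
  have hdw : ‖d • w‖ ≤ R := by
    rw [norm_smul, Real.norm_eq_abs]
    calc |d| * ‖w‖ ≤ R / (max W 0 + 1) * (max W 0 + 1) := by gcongr; linarith
      _ = R := by field_simp
  have hy : X t + d • w ∈ closedBall x₀ (2 * R) := by
    have h1 := hXR t ht
    rw [mem_closedBall, dist_eq_norm] at h1 ⊢
    calc ‖X t + d • w - x₀‖ = ‖(X t - x₀) + d • w‖ := by congr 1; abel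
      _ ≤ ‖X t - x₀‖ + ‖d • w‖ := norm_add_le _ _
      _ ≤ 2 * R := by linarith
  have hp₀ : (ε₀, t) ∈ unitSquare := ⟨hε₀, hs ht⟩
  have hp : (ε, t) ∈ unitSquare := ⟨hε, hs ht⟩
  set u₀ := u (ε₀, t) with hu₀
  set u₁ := u (ε, t) with hu₁
  set D := fderivWithin ℝ u unitSquare (ε₀, t) (1, 0) with hD
  set vt := fderivWithin ℝ v unitSquare (ε₀, t) (0, 1) with hvt
  have hdiff := fun k => differentiableAt_uncurry_of_mem hT hΦ (hXT t ht) k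
  refine ⟨hy, Φ (X t) u₀ + d • fderiv ℝ Ψ (X t, v (ε₀, t)) (Φ (X t) u₀, vt), ?_, ?_⟩
  · refine (hX t ht).add (HasDerivWithinAt.const_smul d ?_)
    exact (hdiff (v (ε₀, t))).hasFDerivAt.comp_hasDerivWithinAt t
      ((hX t ht).prodMk (hasDerivWithinAt_slice hv hε₀ hs ht))
  have hq₀ : (X t, u₀) ∈ K :=
    ⟨closedBall_subset_closedBall (by linarith) (hXR t ht), by
      simpa using Or.inl (hU _ hp₀)⟩
  have hq : (X t + d • w, u₁) ∈ K := ⟨hy, by simpa using Or.inl (hU _ hp)⟩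
  have hfw : fderivWithin ℝ Ψ K (X t, u₀) = fderiv ℝ Ψ (X t, u₀) :=
    (hdiff u₀).fderivWithin (hKu _ hq₀)
  have tay := hTay _ hq₀ _ hq
  rw [hfw] at tay
  have hpp : ((ε, t) : ℝ × ℝ) - (ε₀, t) = d • ((1 : ℝ), (0 : ℝ)) := by
    ext <;> simp [hd]
  have tayu := hTayu _ hp₀ _ hp
  rw [hpp, map_smul] at tayu
  have hn10 : ‖d • ((1 : ℝ), (0 : ℝ))‖ = |d| := by simp [Prod.norm_def]
  rw [hn10, sq_abs] at tayu
  change ‖u₁ - u₀ - d • D‖ ≤ _ at tayu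
  have hul : ‖u₁ - u₀‖ ≤ Lu * |d| := by
    have := hLu.dist_le_mul _ hp _ hp₀
    rwa [dist_eq_norm, dist_eq_norm, hpp, hn10] at this
  have hqq : ((X t + d • w, u₁) : V × V) - (X t, u₀) = d • (w, (0 : V)) + (0, u₁ - u₀) := by
    ext <;> simp
  have hnq : ‖((X t + d • w, u₁) : V × V) - (X t, u₀)‖ ≤ N * |d| := by
    rw [Prod.norm_def]
    refine max_le ?_ ?_
    · simp only [Prod.fst_sub, add_sub_cancel_left, norm_smul, Real.norm_eq_abs]
      rw [mul_comm]
      gcongr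
      exact (hW t ht).trans ((le_max_left _ _).trans (le_max_left _ _))
    · simp only [Prod.snd_sub]
      refine hul.trans ?_
      gcongr
      exact (le_max_right _ _).trans (le_max_left _ _)
  rw [hqq, map_add, map_smul, fderiv_uncurry_inr hT hΦ (hXT t ht), ← hqq] at tay
  have tay' : ‖Φ (X t + d • w) u₁ - Φ (X t) u₀
      - (d • fderiv ℝ Ψ (X t, u₀) (w, 0) + Φ (X t) (u₁ - u₀))‖ ≤ C₁ * N ^ 2 * d ^ 2 := by
    refine tay.trans ?_
    rw [mul_assoc, ← sq_abs d, ← mul_pow]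
    gcongr
  have hmc := hMC (X t) (hXT t ht) u₀ (v (ε₀, t))
  have hfl := hflat _ hp₀
  change vt - D = - b u₀ (v (ε₀, t)) at hfl
  have hsplit : fderiv ℝ Ψ (X t, v (ε₀, t)) (Φ (X t) u₀, vt) =
      fderiv ℝ Ψ (X t, v (ε₀, t)) (Φ (X t) u₀, 0) + Φ (X t) vt := by
    rw [← fderiv_uncurry_inr hT hΦ (hXT t ht) (v (ε₀, t)) vt, ← map_add]
    simp
  have hid : fderiv ℝ Ψ (X t, v (ε₀, t)) (Φ (X t) u₀, vt) =
      fderiv ℝ Ψ (X t, u₀) (w, 0) + Φ (X t) D := by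
    have h1 : D = vt + b u₀ (v (ε₀, t)) := by
      rw [eq_neg_iff_add_eq_zero] at hfl
      rw [← sub_eq_zero, ← neg_eq_zero, ← hfl]; abel
    rw [hsplit, h1, map_add, ← hmc]
    abel
  have e1 : Φ (X t) u₀ + d • fderiv ℝ Ψ (X t, v (ε₀, t)) (Φ (X t) u₀, vt) -
      Φ (X t + d • w) u₁ =
      -(Φ (X t + d • w) u₁ - Φ (X t) u₀
        - (d • fderiv ℝ Ψ (X t, u₀) (w, 0) + Φ (X t) (u₁ - u₀)))
      - Φ (X t) (u₁ - u₀ - d • D) := by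
    rw [hid, map_sub (Φ (X t)) (u₁ - u₀), map_smul, smul_add]
    abel
  rw [e1]
  calc _ ≤ C₁ * N ^ 2 * d ^ 2 + M * (C₂ * d ^ 2) := by
        refine (norm_sub_le _ _).trans (add_le_add ?_ ?_)
        · rwa [norm_neg]
        · refine (hΦM _ (hXR t ht) _).trans ?_
          gcongr
    _ = _ := by ring

/-- The variation `Φ x v` of solutions of `x' = Φ x u` in the parameter is propagated along the
solutions if the form `v dε + u dt` is flat. -/
theorem hasDerivWithinAt_parameter (hT : IsOpen T)
    (hΦ : ContDiffOn ℝ ∞ (fun p : V × V => Φ p.1 p.2) (T ×ˢ univ))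
    (hMC : MaurerCartanOn Φ T b) (hu : ContDiffOn ℝ ∞ u unitSquare)
    (hv : ContDiffOn ℝ ∞ v unitSquare) (hflat : FlatOnSquare b u v)
    {x₀ : V} {R : ℝ} (hR : 0 < R) (hRT : closedBall x₀ (2 * R) ⊆ T)
    {ε₀ t₀ t₁ : ℝ} (hε₀ : ε₀ ∈ Icc (0 : ℝ) 1) (h01 : t₀ ≤ t₁) (hs : Icc t₀ t₁ ⊆ Icc 0 1)
    {x : ℝ → ℝ → V}
    (hx : ∀ᶠ ε in 𝓝[Icc 0 1] ε₀, ∀ t ∈ Icc t₀ t₁, x ε t ∈ closedBall x₀ R ∧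
      HasDerivWithinAt (x ε) (Φ (x ε t) (u (ε, t))) (Icc t₀ t₁) t)
    (h₀ : HasDerivWithinAt (fun ε => x ε t₀) (Φ (x ε₀ t₀) (v (ε₀, t₀))) (Icc 0 1) ε₀) :
    HasDerivWithinAt (fun ε => x ε t₁) (Φ (x ε₀ t₁) (v (ε₀, t₁))) (Icc 0 1) ε₀ := by
  have hx₀ := hx.self_of_nhdsWithin hε₀
  obtain ⟨C, δ, hC, hδ, H⟩ := exists_defect_bound hT hΦ hMC hu hv hflat hR hRT hε₀ hs
    (fun t ht => (hx₀ t ht).1) (fun t ht => (hx₀ t ht).2)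
  obtain ⟨U, hU⟩ := isCompact_unitSquare.exists_bound_of_continuousOn hu.continuousOn
  have hKc : IsCompact (closedBall x₀ (2 * R) ×ˢ closedBall (0 : V) U) :=
    (isCompact_closedBall _ _).prod (isCompact_closedBall _ _)
  obtain ⟨K, hK⟩ := ((hΦ.mono (prod_mono hRT (subset_univ _))).of_le
    (by simp)).exists_lipschitzOnWith_of_isCompact hKc
    ((convex_closedBall _ _).prod (convex_closedBall _ _))
  rw [hasDerivWithinAt_iff_isLittleO] at h₀ ⊢
  set G₁ := gronwallBound 1 K 0 (t₁ - t₀)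
  set G₂ := gronwallBound 0 K 1 (t₁ - t₀)
  have hball : ∀ᶠ ε in 𝓝[Icc 0 1] ε₀, |ε - ε₀| ≤ δ := by
    refine mem_nhdsWithin_of_mem_nhds ?_
    filter_upwards [closedBall_mem_nhds ε₀ hδ] with ε hε
    simpa [Real.dist_eq] using hε
  have hsmall : (fun ε : ℝ => (ε - ε₀) ^ 2) =o[𝓝[Icc 0 1] ε₀] fun ε => ε - ε₀ := by
    have h1 : Tendsto (fun ε : ℝ => ε - ε₀) (𝓝[Icc 0 1] ε₀) (𝓝 0) := by
      refine tendsto_nhdsWithin_of_tendsto_nhds ?_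
      exact Continuous.tendsto' (by fun_prop) _ _ (by simp)
    have h2 : (fun ε : ℝ => (ε - ε₀) * (ε - ε₀)) =o[𝓝[Icc 0 1] ε₀]
        fun ε => (1 : ℝ) * (ε - ε₀) :=
      ((Asymptotics.isLittleO_one_iff ℝ).2 h1).mul_isBigO (Asymptotics.isBigO_refl _ _)
    simpa [sq] using h2
  refine Asymptotics.IsBigO.trans_isLittleO (g := fun ε => G₁ * ‖x ε t₀ - x ε₀ t₀ -
    (ε - ε₀) • Φ (x ε₀ t₀) (v (ε₀, t₀))‖ + G₂ * C * (ε - ε₀) ^ 2) ?_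
    ((h₀.norm_left.const_mul_left _).add (hsmall.const_mul_left _))
  refine Asymptotics.IsBigO.of_bound 1 ?_
  filter_upwards [hx, hball, self_mem_nhdsWithin] with ε hxε hεδ hε
  set y : ℝ → V := fun t => x ε₀ t + (ε - ε₀) • Φ (x ε₀ t) (v (ε₀, t)) with hy
  choose! hyR y' hy' hyb using H ε hε hεδ
  have hIci : ∀ t ∈ Ico t₀ t₁, Icc t₀ t₁ ∈ 𝓝[Ici t] t := fun t ht =>
    Icc_mem_nhdsGE_of_mem ht
  have key := dist_le_of_approx_trajectories_ODE_of_mem (v := fun t z => Φ z (u (ε, t)))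
    (s := fun _ => closedBall x₀ (2 * R)) (K := K) (f := x ε) (g := y)
    (f' := fun t => Φ (x ε t) (u (ε, t))) (g' := y') (a := t₀) (b := t₁) (εf := 0)
    (εg := C * (ε - ε₀) ^ 2) (δ := dist (x ε t₀) (y t₀))
    (fun t ht => LipschitzOnWith.of_dist_le_mul fun z hz z' hz' => by
      have hUt : u (ε, t) ∈ closedBall (0 : V) U := by
        simpa using hU (ε, t) ⟨hε, hs (Ico_subset_Icc_self ht)⟩
      refine (hK.dist_le_mul (z, u (ε, t)) ⟨hz, hUt⟩ (z', u (ε, t)) ⟨hz', hUt⟩).trans ?_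
      simp [Prod.dist_eq])
    (fun t ht => (hxε t ht).2.continuousWithinAt)
    (fun t ht => (hxε t (Ico_subset_Icc_self ht)).2.mono_of_mem_nhdsWithin (hIci t ht))
    (fun t ht => by simp)
    (fun t ht => closedBall_subset_closedBall (by linarith) (hxε t (Ico_subset_Icc_self ht)).1)
    (fun t ht => (hy' t ht).continuousWithinAt)
    (fun t ht => (hy' t (Ico_subset_Icc_self ht)).mono_of_mem_nhdsWithin (hIci t ht))
    (fun t ht => by
      rw [dist_eq_norm]; exact hyb t (Ico_subset_Icc_self ht))
    (fun t ht => hyR t (Ico_subset_Icc_self ht)) le_rfl t₁ (right_mem_Icc.2 h01)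
  rw [gronwallBound_eq_linear, zero_add] at key
  rw [one_mul]
  calc ‖x ε t₁ - x ε₀ t₁ - (ε - ε₀) • Φ (x ε₀ t₁) (v (ε₀, t₁))‖
      = dist (x ε t₁) (y t₁) := by rw [dist_eq_norm, hy, sub_sub]
    _ ≤ _ := key
    _ = G₁ * ‖x ε t₀ - x ε₀ t₀ - (ε - ε₀) • Φ (x ε₀ t₀) (v (ε₀, t₀))‖ +
        G₂ * C * (ε - ε₀) ^ 2 := by
      rw [dist_eq_norm, hy, sub_sub]; ring
    _ ≤ _ := le_abs_self _

end Propagation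

section LieGroupChart

open Set Metric Filter Topology

variable {E H : Type*} [NormedAddCommGroup E] [NormedSpace ℝ E] [TopologicalSpace H]
  {I : ModelWithCorners ℝ E H} {G : Type*} [TopologicalSpace G] [ChartedSpace H G] [Group G]

theorem continuousLinearMapAt_tangentBundle_apply {M : Type*} [TopologicalSpace M]
    [ChartedSpace H M] [IsManifold I 1 M] {g₀ g : M}
    (hg : g ∈ (chartAt H g₀).source) (v : TangentSpace I g) :
    (trivializationAt E (TangentSpace I : M → Type _) g₀).continuousLinearMapAt ℝ g v =
      (trivializationAt E (TangentSpace I : M → Type _) g₀ ⟨g, v⟩).2 := by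
  rw [Trivialization.continuousLinearMapAt_apply]
  exact congrFun (Trivialization.coe_linearMapAt_of_mem _ hg) v

theorem mlieBracket_eq_lieBracket (X Y : Π x : E, TangentSpace 𝓘(ℝ, E) x) (x : E) :
    mlieBracket 𝓘(ℝ, E) X Y x = lieBracket ℝ X Y x := by
  rw [← mlieBracketWithin_univ, mlieBracketWithin_eq_lieBracketWithin]
  exact congrFun lieBracketWithin_univ x

variable (I G) in
/-- The right-invariant vector fields of a Lie group, read in the chart at the identity. -/
def chartRightInvariant (x : E) : E →ₗ[ℝ] E where
  toFun v := mfderiv I 𝓘(ℝ, E) (extChartAt I (1 : G)) ((extChartAt I (1 : G)).symm x)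
    (rightInvariantVectorField (v : GroupLieAlgebra I G) ((extChartAt I (1 : G)).symm x))
  map_add' v w := by
    have h : rightInvariantVectorField ((v + w : E) : GroupLieAlgebra I G)
        ((extChartAt I (1 : G)).symm x) =
        rightInvariantVectorField (v : GroupLieAlgebra I G) ((extChartAt I (1 : G)).symm x) +
        rightInvariantVectorField (w : GroupLieAlgebra I G) ((extChartAt I (1 : G)).symm x) :=
      map_add (mfderiv I I (fun y : G => y * (extChartAt I (1 : G)).symm x) 1) _ _
    rw [h]
    exact map_add _ _ _
  map_smul' c v := by
    have h : rightInvariantVectorField ((c • v : E) : GroupLieAlgebra I G)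
        ((extChartAt I (1 : G)).symm x) =
        c • rightInvariantVectorField (v : GroupLieAlgebra I G)
          ((extChartAt I (1 : G)).symm x) :=
      map_smul (mfderiv I I (fun y : G => y * (extChartAt I (1 : G)).symm x) 1) _ _
    rw [h]
    exact map_smul _ _ _

variable [LieGroup I ∞ G]

theorem contMDiff_rightInvariantVectorField :
    ContMDiff (I.prod 𝓘(ℝ, E)) I.tangent ∞ (fun p : G × E =>
      (⟨p.1, rightInvariantVectorField (p.2 : GroupLieAlgebra I G) p.1⟩ : TangentBundle I G)) := by
  have hI1 : IsManifold I (∞ + 1) G := inferInstanceAs (IsManifold I ∞ G)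
  let fg : G × E → TangentBundle I G := fun p => TotalSpace.mk' E p.1 0
  have sfg : ContMDiff (I.prod 𝓘(ℝ, E)) I.tangent ∞ fg :=
    (contMDiff_zeroSection ℝ (TangentSpace I : G → Type _)).comp contMDiff_fst
  let fv : G × E → TangentBundle I G := fun p => TotalSpace.mk' E 1 p.2
  have sfv : ContMDiff (I.prod 𝓘(ℝ, E)) I.tangent ∞ fv := by
    intro p
    rw [Bundle.contMDiffAt_totalSpace]
    refine ⟨contMDiffAt_const, ?_⟩
    have h : ∀ q : G × E, (trivializationAt E (TangentSpace I : G → Type _) (fv p).proj (fv q)).2 =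
        (trivializationAt E (TangentSpace I : G → Type _) 1).continuousLinearMapAt ℝ 1 q.2 := by
      intro q
      exact (continuousLinearMapAt_tangentBundle_apply
        (by exact mem_chart_source H (1 : G)) (q.2 : TangentSpace I (1 : G))).symm
    simp_rw [h]
    exact ((ContinuousLinearMap.contMDiff _).comp contMDiff_snd).contMDiffAt
  let F₂ : (TangentBundle I G × TangentBundle I G) → TangentBundle (I.prod I) (G × G) :=
    (equivTangentBundleProd I G I G).symm
  have S₂ : ContMDiff (I.tangent.prod I.tangent) (I.prod I).tangent ∞ F₂ :=
    contMDiff_equivTangentBundleProd_symm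
  let F₃ : TangentBundle (I.prod I) (G × G) → TangentBundle I G :=
    tangentMap (I.prod I) I (fun p : G × G => p.1 * p.2)
  have S₃ : ContMDiff (I.prod I).tangent I.tangent ∞ F₃ :=
    ContMDiff.contMDiff_tangentMap (m := ∞) (n := ∞) (contMDiff_mul I ∞) le_rfl
  have S := (S₃.comp S₂).comp (sfv.prodMk sfg)
  convert! S with p
  · simp [F₂, F₃, fg, fv]
  · simp only [Function.comp_apply, tangentMap, F₃, F₂, fg, fv]
    rw [mfderiv_prod_eq_add_apply ((contMDiff_mul I ∞).mdifferentiableAt (by simp))]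
    change _ = mfderiv I I (fun x : G => x * p.1) 1 p.2 +
      mfderiv I I (fun z : G => 1 * z) p.1 (0 : TangentSpace I p.1)
    rw [map_zero, add_zero]
    rfl

theorem mdifferentiableAt_rightInvariantVectorField (v : GroupLieAlgebra I G) (g : G) :
    MDifferentiableAt I I.tangent
      (fun g : G => (⟨g, rightInvariantVectorField v g⟩ : TangentBundle I G)) g := by
  have h : ∀ w : E, ContMDiff I (I.prod 𝓘(ℝ, E)) ∞ (fun g : G => (g, w)) := fun w =>
    contMDiff_id.prodMk contMDiff_const
  exact ((contMDiff_rightInvariantVectorField (I := I) (G := G)).comp (h v)).mdifferentiable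
    (by simp) g

theorem mlieBracket_rightInvariantVectorField [FiniteDimensional ℝ E]
    (v w : GroupLieAlgebra I G) (g : G) :
    mlieBracket I (rightInvariantVectorField v) (rightInvariantVectorField w) g =
      rightInvariantVectorField (rightBracket v w) g := by
  have hc := FiniteDimensional.complete ℝ E
  have h3 := lieGroup_three (I := I) (G := G)
  rw [rightBracket_eq]
  simp only [rightInvariantVectorField_eq, invDeriv_invDeriv]
  rw [← mpullback_mlieBracket (n := minSmoothness ℝ 3), GroupLieAlgebra.bracket_def,
    mulInvariantVector_mlieBracket]
  · exact mdifferentiableAt_mulInvariantVectorField _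
  · exact mdifferentiableAt_mulInvariantVectorField _
  · exact (contMDiff_inv I _).contMDiffAt
  · exact minSmoothness_monotone (by norm_cast)

theorem contDiffOn_chartRightInvariant :
    ContDiffOn ℝ ∞ (fun p : E × E => chartRightInvariant I G p.1 p.2)
      ((extChartAt I (1 : G)).target ×ˢ univ) := by
  rw [← contMDiffOn_iff_contDiffOn, modelWithCornersSelf_prod, ← chartedSpaceSelf_prod]
  set e := trivializationAt E (TangentSpace I : G → Type _) 1 with he
  have h1 : ContMDiffOn (𝓘(ℝ, E).prod 𝓘(ℝ, E)) I.tangent ∞ (fun p : E × E =>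
      (⟨(extChartAt I (1 : G)).symm p.1, rightInvariantVectorField (p.2 : GroupLieAlgebra I G)
        ((extChartAt I (1 : G)).symm p.1)⟩ : TangentBundle I G))
      ((extChartAt I (1 : G)).target ×ˢ univ) := by
    refine (contMDiff_rightInvariantVectorField (I := I) (G := G)).comp_contMDiffOn
      (f := fun p : E × E => ((extChartAt I (1 : G)).symm p.1, p.2)) ?_
    refine ContMDiffOn.prodMk ?_ contMDiffOn_snd
    exact (contMDiffOn_extChartAt_symm 1).comp contMDiffOn_fst fun p hp => hp.1
  have hmem : ∀ p ∈ (extChartAt I (1 : G)).target ×ˢ (univ : Set E),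
      (extChartAt I (1 : G)).symm p.1 ∈ (chartAt H (1 : G)).source := fun p hp => by
    rw [← extChartAt_source I]; exact (extChartAt I (1 : G)).map_target hp.1
  have h2 := ((e.contMDiffOn_iff (IB := I) (n := ∞) (fun p hp => by
    rw [e.mem_source]; exact hmem p hp)).1 h1).2
  refine h2.congr fun p hp => ?_
  refine Eq.trans ?_ (continuousLinearMapAt_tangentBundle_apply (hmem p hp) _)
  rw [TangentBundle.continuousLinearMapAt_trivializationAt (hmem p hp)]
  rfl

variable [I.Boundaryless]

theorem mpullback_extChartAt_symm_rightInvariantVectorField (v : GroupLieAlgebra I G) {x : E}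
    (hx : x ∈ (extChartAt I (1 : G)).target) :
    mpullback 𝓘(ℝ, E) I (extChartAt I (1 : G)).symm (rightInvariantVectorField v) x =
      chartRightInvariant I G x v := by
  rw [mpullback_apply]
  have h1 := mfderiv_extChartAt_comp_mfderivWithin_extChartAt_symm (I := I) hx
  have h2 := mfderivWithin_extChartAt_symm_comp_mfderiv_extChartAt (I := I) hx
  rw [I.range_eq_univ, mfderivWithin_univ] at h1 h2
  rw [ContinuousLinearMap.inverse_eq h2 h1]
  rfl

theorem maurerCartanOn_chartRightInvariant [FiniteDimensional ℝ E] :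
    MaurerCartanOn (chartRightInvariant I G) (extChartAt I (1 : G)).target
      (fun v w : E => rightBracket (I := I) (G := G) v w) := by
  intro x hx u v
  have hc := FiniteDimensional.complete ℝ E
  have hM : IsManifold I (minSmoothness ℝ 3) G := by
    simp only [minSmoothness_of_isRCLikeNormedField]; infer_instance
  have hT : IsOpen (extChartAt I (1 : G)).target := isOpen_extChartAt_target 1
  have hfd : ∀ w h : E, fderiv ℝ (fun p : E × E => chartRightInvariant I G p.1 p.2) (x, w) (h, 0) =
      fderiv ℝ (fun y : E => chartRightInvariant I G y w) x h := fun w h => by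
    have h0 : HasFDerivAt (fun y : E => (y, w)) (ContinuousLinearMap.inl ℝ E E) x :=
      hasFDerivAt_prodMk_left x w
    have h1 := (differentiableAt_uncurry_of_mem hT
      contDiffOn_chartRightInvariant hx w).hasFDerivAt.comp x h0
    have h2 : fderiv ℝ (fun y : E => chartRightInvariant I G y w) x = _ := h1.fderiv
    rw [h2]
    rfl
  rw [hfd, hfd]
  have hev : ∀ w : E, mpullback 𝓘(ℝ, E) I (extChartAt I (1 : G)).symm
      (rightInvariantVectorField (w : GroupLieAlgebra I G)) =ᶠ[𝓝 x]
      fun y => chartRightInvariant I G y w := fun w => by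
    filter_upwards [hT.mem_nhds hx] with y hy
    exact mpullback_extChartAt_symm_rightInvariantVectorField _ hy
  have key := mpullback_mlieBracket (n := ∞) (I := 𝓘(ℝ, E)) (I' := I)
    (f := (extChartAt I (1 : G)).symm) (x₀ := x)
    (mdifferentiableAt_rightInvariantVectorField (u : GroupLieAlgebra I G) _)
    (mdifferentiableAt_rightInvariantVectorField (v : GroupLieAlgebra I G) _)
    ((contMDiffOn_extChartAt_symm 1).contMDiffAt (hT.mem_nhds hx))
    (by rw [minSmoothness_of_isRCLikeNormedField]; exact ENat.LEInfty.out)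
  rw [(hev u).mlieBracket_vectorField_eq (hev v)] at key
  refine Eq.trans ?_ ((key.trans (mlieBracket_eq_lieBracket _ _ x)).symm.trans ?_)
  · rfl
  · rw [← mpullback_extChartAt_symm_rightInvariantVectorField _ hx, mpullback_apply,
      mpullback_apply]
    exact congrArg _ (mlieBracket_rightInvariantVectorField _ _ _)

end LieGroupChart

section RightLogDeriv

open Set Metric Filter Topology NNReal

variable {E H : Type*} [NormedAddCommGroup E] [NormedSpace ℝ E] [TopologicalSpace H]
  {I : ModelWithCorners ℝ E H} {G : Type*} [TopologicalSpace G] [ChartedSpace H G] [Group G]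

theorem comp_toSpanSingleton_eq {V W : Type*} [NormedAddCommGroup V] [NormedSpace ℝ V]
    [NormedAddCommGroup W] [NormedSpace ℝ W] {L : V →L[ℝ] W} {v : V} {w : W} (h : L v = w) :
    L.comp (ContinuousLinearMap.toSpanSingleton ℝ v) = ContinuousLinearMap.toSpanSingleton ℝ w := by
  ext; simp [h]

variable (I) in
/-- The curve `g` in a Lie group is differentiable at `t` within `s`, with `ġ(t) g(t)⁻¹ = ξ`. -/
def HasRightLogDerivWithinAt (g : ℝ → G) (ξ : E) (s : Set ℝ) (t : ℝ) : Prop :=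
  HasMFDerivWithinAt 𝓘(ℝ, ℝ) I g s t (ContinuousLinearMap.toSpanSingleton ℝ
    (rightInvariantVectorField (ξ : GroupLieAlgebra I G) (g t) : E))

namespace HasRightLogDerivWithinAt

variable {g h : ℝ → G} {ξ : E} {s s' : Set ℝ} {t : ℝ}

theorem continuousWithinAt (hg : HasRightLogDerivWithinAt I g ξ s t) : ContinuousWithinAt g s t :=
  HasMFDerivWithinAt.continuousWithinAt hg

theorem mono (hg : HasRightLogDerivWithinAt I g ξ s t) (hs : s' ⊆ s) :
    HasRightLogDerivWithinAt I g ξ s' t :=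
  HasMFDerivWithinAt.mono hg hs

theorem mono_of_mem_nhdsWithin (hg : HasRightLogDerivWithinAt I g ξ s t) (hs : s ∈ 𝓝[s'] t) :
    HasRightLogDerivWithinAt I g ξ s' t :=
  HasMFDerivWithinAt.mono_of_mem_nhdsWithin hg hs

theorem union (hg : HasRightLogDerivWithinAt I g ξ s t)
    (hg' : HasRightLogDerivWithinAt I g ξ s' t) : HasRightLogDerivWithinAt I g ξ (s ∪ s') t :=
  HasMFDerivWithinAt.union hg hg'

theorem congr_of_eventuallyEq (hg : HasRightLogDerivWithinAt I g ξ s t) (h₁ : h =ᶠ[𝓝[s] t] g)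
    (ht : h t = g t) : HasRightLogDerivWithinAt I h ξ s t := by
  have := HasMFDerivWithinAt.congr_of_eventuallyEq hg h₁ ht
  unfold HasRightLogDerivWithinAt
  rw [ht]
  exact this

theorem congr (hg : HasRightLogDerivWithinAt I g ξ s t) (h₁ : ∀ x ∈ s, h x = g x)
    (ht : h t = g t) : HasRightLogDerivWithinAt I h ξ s t :=
  hg.congr_of_eventuallyEq (eventually_of_mem self_mem_nhdsWithin h₁) ht

end HasRightLogDerivWithinAt

theorem exists_hasRightLogDerivWithinAt_glue {a b c : ℝ} (hab : a ≤ b) (hbc : b ≤ c) {ξ : ℝ → E}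
    {g h : ℝ → G} (hg : ∀ t ∈ Icc a b, HasRightLogDerivWithinAt I g (ξ t) (Icc a b) t)
    (hh : ∀ t ∈ Icc b c, HasRightLogDerivWithinAt I h (ξ t) (Icc b c) t) (hb : g b = h b) :
    ∃ k : ℝ → G, k a = g a ∧
      ∀ t ∈ Icc a c, HasRightLogDerivWithinAt I k (ξ t) (Icc a c) t := by
  set k : ℝ → G := fun t => if t ≤ b then g t else h t with hk
  have hkg : ∀ t ≤ b, k t = g t := fun t ht => if_pos ht
  have hkh : ∀ t, b ≤ t → k t = h t := fun t ht => by
    rcases ht.eq_or_lt with rfl | ht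
    · rw [hkg _ le_rfl, hb]
    · exact if_neg ht.not_ge
  have h1 : ∀ t ∈ Icc a b, HasRightLogDerivWithinAt I k (ξ t) (Icc a b) t := fun t ht =>
    (hg t ht).congr (fun x hx => hkg x hx.2) (hkg t ht.2)
  have h2 : ∀ t ∈ Icc b c, HasRightLogDerivWithinAt I k (ξ t) (Icc b c) t := fun t ht =>
    (hh t ht).congr (fun x hx => hkh x hx.1) (hkh t ht.1)
  refine ⟨k, hkg a hab, fun t ht => ?_⟩
  rcases lt_trichotomy t b with htb | rfl | htb
  · refine (h1 t ⟨ht.1, htb.le⟩).mono_of_mem_nhdsWithin ?_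
    filter_upwards [self_mem_nhdsWithin, mem_nhdsWithin_of_mem_nhds (Iio_mem_nhds htb)] with s hs hs'
    exact ⟨hs.1, le_of_lt hs'⟩
  · have := (h1 t ⟨hab, le_rfl⟩).union (h2 t ⟨le_rfl, hbc⟩)
    rwa [Icc_union_Icc_eq_Icc hab hbc] at this
  · refine (h2 t ⟨htb.le, ht.2⟩).mono_of_mem_nhdsWithin ?_
    filter_upwards [self_mem_nhdsWithin, mem_nhdsWithin_of_mem_nhds (Ioi_mem_nhds htb)] with s hs hs'
    exact ⟨le_of_lt hs', hs.2⟩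

theorem chartRightInvariant_extChartAt {g : G} (hg : g ∈ (extChartAt I (1 : G)).source) (v : E) :
    chartRightInvariant I G (extChartAt I (1 : G) g) v =
      mfderiv I 𝓘(ℝ, E) (extChartAt I (1 : G)) g
        (rightInvariantVectorField (v : GroupLieAlgebra I G) g) := by
  have h : ∀ g' : G, g' = g → (mfderiv I 𝓘(ℝ, E) (extChartAt I (1 : G)) g'
      (rightInvariantVectorField (v : GroupLieAlgebra I G) g') : E) =
      mfderiv I 𝓘(ℝ, E) (extChartAt I (1 : G)) g
        (rightInvariantVectorField (v : GroupLieAlgebra I G) g) := by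
    rintro _ rfl; rfl
  exact h _ ((extChartAt I (1 : G)).left_inv hg)

variable [LieGroup I ∞ G]

theorem mfderiv_mul_right_rightInvariantVectorField (v : GroupLieAlgebra I G) (g c : G) :
    mfderiv I I (fun x : G => x * c) g (rightInvariantVectorField v g) =
      rightInvariantVectorField v (g * c) := by
  have h : (fun x : G => x * (g * c)) = (fun x : G => x * c) ∘ fun x : G => x * g := by
    ext x; simp [mul_assoc]
  unfold rightInvariantVectorField
  have h1 : mfderiv I I (fun x : G => x * (g * c)) 1 =
      (mfderiv I I (fun x : G => x * c) (1 * g)).comp (mfderiv I I (fun x : G => x * g) 1) := by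
    rw [h]
    exact mfderiv_comp (I' := I) _ (mdiff_mul_right _ _) (mdiff_mul_right _ _)
  have h2 : ∀ g' : G, g' = g → ∀ w : E, (mfderiv I I (fun x : G => x * c) g' w : E) =
      mfderiv I I (fun x : G => x * c) g w := by
    rintro _ rfl _; rfl
  exact ((congrArg (fun L : E →L[ℝ] E => L v) h1).trans (h2 _ (one_mul g) _)).symm

theorem HasRightLogDerivWithinAt.mul_const {g : ℝ → G} {ξ : E} {s : Set ℝ} {t : ℝ}
    (hg : HasRightLogDerivWithinAt I g ξ s t) (c : G) :
    HasRightLogDerivWithinAt I (fun t => g t * c) ξ s t := by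
  have h1 := ((mdiff_mul_right (I := I) c (g t)).hasMFDerivAt).comp_hasMFDerivWithinAt t hg
  refine HasMFDerivWithinAt.congr_mfderiv h1 ?_
  exact comp_toSpanSingleton_eq (V := E) (W := E)
    (mfderiv_mul_right_rightInvariantVectorField (I := I) ξ (g t) c)

theorem HasRightLogDerivWithinAt.hasDerivWithinAt_chart {g : ℝ → G} {ξ : E} {s : Set ℝ} {t : ℝ}
    (hg : HasRightLogDerivWithinAt I g ξ s t) (ht : g t ∈ (extChartAt I (1 : G)).source) :
    HasDerivWithinAt (fun t => extChartAt I (1 : G) (g t))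
      (chartRightInvariant I G (extChartAt I (1 : G) (g t)) ξ) s t := by
  have ht' : g t ∈ (chartAt H (1 : G)).source := by rwa [← extChartAt_source I]
  have h1 := ((mdifferentiableAt_extChartAt (I := I) ht').hasMFDerivAt).comp_hasMFDerivWithinAt t hg
  exact hasMFDerivWithinAt_iff_hasFDerivWithinAt.1 (h1.congr_mfderiv
    (comp_toSpanSingleton_eq (V := E) (W := E) (chartRightInvariant_extChartAt ht ξ).symm))

theorem eventually_mem_chart {g : ℝ → G} {s : Set ℝ} {t : ℝ} (hg : ContinuousWithinAt g s t)
    {R : ℝ} (hR : 0 < R) : ∀ᶠ r in 𝓝[s] t, g r * (g t)⁻¹ ∈ (extChartAt I (1 : G)).source ∧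
      extChartAt I (1 : G) (g r * (g t)⁻¹) ∈ closedBall (extChartAt I (1 : G) 1) R := by
  have : IsTopologicalGroup G := topologicalGroup_of_lieGroup I ∞
  have h1 : Tendsto (fun r => g r * (g t)⁻¹) (𝓝[s] t) (𝓝 1) := by
    simpa using Tendsto.mul_const (g t)⁻¹ hg
  exact (h1.eventually (extChartAt_source_mem_nhds 1)).and
    (h1.eventually ((continuousAt_extChartAt (I := I) (1 : G)).eventually
      (closedBall_mem_nhds _ hR)))

theorem contMDiffOn_of_hasRightLogDerivWithinAt [FiniteDimensional ℝ E] {ξ : ℝ → E}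
    (hξ : ContDiffOn ℝ ∞ ξ (Icc 0 1))
    {g : ℝ → G} (hg : ∀ t ∈ Icc (0 : ℝ) 1, HasRightLogDerivWithinAt I g (ξ t) (Icc 0 1) t) :
    ContMDiffOn 𝓘(ℝ, ℝ) I ∞ g (Icc 0 1) := by
  intro t ht
  have hev := (eventually_mem_chart (I := I) (hg t ht).continuousWithinAt one_pos)
  obtain ⟨δ, hδ, hδs⟩ := (nhdsWithin_hasBasis Metric.nhds_basis_closedBall _).mem_iff.1 hev
  rw [Real.closedBall_eq_Icc, Icc_inter_Icc] at hδs
  set p := max (t - δ) 0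
  set q := min (t + δ) 1
  have hsub : Icc p q ⊆ Icc 0 1 := Icc_subset_Icc (le_max_right _ _) (min_le_right _ _)
  have htpq : t ∈ Icc p q :=
    ⟨max_le (by linarith) ht.1, le_min (by linarith) ht.2⟩
  have hnhds : Icc p q ∈ 𝓝[Icc 0 1] t := by
    rw [← Icc_inter_Icc, ← Real.closedBall_eq_Icc]
    exact inter_mem (mem_nhdsWithin_of_mem_nhds (closedBall_mem_nhds _ hδ)) self_mem_nhdsWithin
  have hx : ContDiffOn ℝ ∞ (fun s => extChartAt I (1 : G) (g s * (g t)⁻¹)) (Icc p q) := by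
    refine ODE.contDiffOn_enat_Icc_of_hasDerivWithinAt (n := ⊤)
      (f := fun s x => chartRightInvariant I G x (ξ s)) (u := (extChartAt I (1 : G)).target) ?_
      (fun s hs => ((hg s (hsub hs)).mono hsub |>.mul_const (g t)⁻¹).hasDerivWithinAt_chart
        (hδs hs).1) (fun s hs => (extChartAt I (1 : G)).map_source (hδs hs).1)
    have h1 : ContDiffOn ℝ ∞ (fun z : ℝ × E => (z.2, ξ z.1))
        (Icc p q ×ˢ (extChartAt I (1 : G)).target) :=
      contDiffOn_snd.prodMk ((hξ.mono hsub).comp contDiffOn_fst fun z hz => hz.1)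
    exact (contDiffOn_chartRightInvariant (I := I) (G := G)).comp h1
      fun z hz => ⟨hz.2, mem_univ _⟩
  have hmul : ContMDiff I I ∞ (fun x : G => x * g t) := contMDiff_mul_right
  have h2 : ContMDiffOn 𝓘(ℝ, ℝ) I ∞ (fun s => (extChartAt I (1 : G)).symm
      (extChartAt I (1 : G) (g s * (g t)⁻¹)) * g t) (Icc p q) :=
    hmul.comp_contMDiffOn ((contMDiffOn_extChartAt_symm (1 : G)).comp hx.contMDiffOn
      fun s hs => (extChartAt I (1 : G)).map_source (hδs hs).1)
  have h3 : ContMDiffOn 𝓘(ℝ, ℝ) I ∞ g (Icc p q) := h2.congr fun s hs => by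
    rw [(extChartAt I (1 : G)).left_inv (hδs hs).1, inv_mul_cancel_right]
  exact (h3 t htpq).mono_of_mem_nhdsWithin hnhds

variable [I.Boundaryless]

theorem hasRightLogDerivWithinAt_of_chart {x : ℝ → E} {ξ : E} {s : Set ℝ} {t : ℝ}
    (hx : HasDerivWithinAt x (chartRightInvariant I G (x t) ξ) s t)
    (ht : x t ∈ (extChartAt I (1 : G)).target) :
    HasRightLogDerivWithinAt I (fun t => (extChartAt I (1 : G)).symm (x t)) ξ s t := by
  have hd : MDifferentiableAt 𝓘(ℝ, E) I (extChartAt I (1 : G)).symm (x t) :=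
    ((contMDiffOn_extChartAt_symm (n := ∞) 1).contMDiffAt
      ((isOpen_extChartAt_target 1).mem_nhds ht)).mdifferentiableAt (by simp)
  have h1 := hd.hasMFDerivAt.comp_hasMFDerivWithinAt t hx.hasFDerivWithinAt.hasMFDerivWithinAt
  refine HasMFDerivWithinAt.congr_mfderiv h1 ?_
  have h2 := mfderivWithin_extChartAt_symm_comp_mfderiv_extChartAt (I := I) ht
  rw [I.range_eq_univ, mfderivWithin_univ] at h2
  exact comp_toSpanSingleton_eq (V := E) (W := E) (DFunLike.congr_fun h2
    (rightInvariantVectorField (ξ : GroupLieAlgebra I G) ((extChartAt I (1 : G)).symm (x t))))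

variable [FiniteDimensional ℝ E]

/-- A curve in a Lie group is determined by its initial value and its right logarithmic
derivative. -/
theorem eqOn_of_hasRightLogDerivWithinAt [T2Space G] {a b : ℝ} {ξ : ℝ → E} {g h : ℝ → G}
    (hξ : ContinuousOn ξ (Icc a b))
    (hg : ∀ t ∈ Icc a b, HasRightLogDerivWithinAt I g (ξ t) (Icc a b) t)
    (hh : ∀ t ∈ Icc a b, HasRightLogDerivWithinAt I h (ξ t) (Icc a b) t)
    (h0 : g a = h a) : EqOn g h (Icc a b) := by
  obtain ⟨R, hR, hRT⟩ := Metric.nhds_basis_closedBall.mem_iff.1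
    (extChartAt_target_mem_nhds (I := I) (1 : G))
  obtain ⟨U, hU⟩ := isCompact_Icc.exists_bound_of_continuousOn hξ
  have hKc : IsCompact (closedBall (extChartAt I (1 : G) 1) R ×ˢ closedBall (0 : E) U) :=
    (isCompact_closedBall _ _).prod (isCompact_closedBall _ _)
  obtain ⟨K, hK⟩ := (((contDiffOn_chartRightInvariant (I := I) (G := G)).mono
    (prod_mono hRT (subset_univ _))).of_le (by simp)).exists_lipschitzOnWith_of_isCompact hKc
    ((convex_closedBall _ _).prod (convex_closedBall _ _))
  have hgc : ContinuousOn g (Icc a b) := fun t ht => (hg t ht).continuousWithinAt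
  have hhc : ContinuousOn h (Icc a b) := fun t ht => (hh t ht).continuousWithinAt
  have hclosed : IsClosed ({t | g t = h t} ∩ Icc a b) := by
    have := (hgc.prodMk hhc).preimage_isClosed_of_isClosed isClosed_Icc isClosed_diagonal
    rwa [inter_comm] at this
  refine fun t ht => hclosed.Icc_subset_of_forall_exists_gt h0 (fun t ht y hy => ?_) ht
  obtain ⟨htt : g t = h t, ht⟩ := ht
  have ht' := Ico_subset_Icc_self ht
  have hnhds : Icc a b ∈ 𝓝[Ici t] t := Icc_mem_nhdsGE_of_mem ht
  have hev := (nhdsWithin_le_of_mem hnhds) ((eventually_mem_chart (I := I) (hgc t ht') hR).and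
    (eventually_mem_chart (I := I) (hhc t ht') hR))
  obtain ⟨z, hz, hzs⟩ := mem_nhdsGE_iff_exists_Icc_subset.1 (inter_mem hev hnhds)
  set y' := min z y
  have hty' : t < y' := lt_min hz hy
  have hsub : Icc t y' ⊆ Icc a b := fun s hs =>
    (hzs ⟨hs.1, hs.2.trans (min_le_left _ _)⟩).2
  have hchart : ∀ k : ℝ → G, (∀ t ∈ Icc a b, HasRightLogDerivWithinAt I k (ξ t) (Icc a b) t) →
      (∀ s ∈ Icc t y', k s * (k t)⁻¹ ∈ (extChartAt I (1 : G)).source) → ∀ s ∈ Icc t y',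
      HasDerivWithinAt (fun s => extChartAt I (1 : G) (k s * (k t)⁻¹))
        (chartRightInvariant I G (extChartAt I (1 : G) (k s * (k t)⁻¹)) (ξ s)) (Icc t y') s :=
    fun k hk hks s hs =>
      ((hk s (hsub hs)).mono hsub |>.mul_const (k t)⁻¹).hasDerivWithinAt_chart (hks s hs)
  have hmem : ∀ s ∈ Icc t y', s ∈ Icc t z := fun s hs => ⟨hs.1, hs.2.trans (min_le_left _ _)⟩
  have hgs := hchart g hg fun s hs => (hzs (hmem s hs)).1.1.1
  have hhs := hchart h hh fun s hs => (hzs (hmem s hs)).1.2.1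
  have hIci : ∀ s ∈ Ico t y', Icc t y' ∈ 𝓝[Ici s] s := fun s hs => Icc_mem_nhdsGE_of_mem hs
  have key := ODE_solution_unique_of_mem_Icc_right (a := t) (b := y') (K := K)
    (v := fun s x => chartRightInvariant I G x (ξ s))
    (s := fun _ => closedBall (extChartAt I (1 : G) 1) R)
    (f := fun s => extChartAt I (1 : G) (g s * (g t)⁻¹))
    (g := fun s => extChartAt I (1 : G) (h s * (h t)⁻¹))
    (fun s hs => LipschitzOnWith.of_dist_le_mul fun x hx x' hx' => by
      have hUt : ξ s ∈ closedBall (0 : E) U := by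
        simpa using hU s (hsub (Ico_subset_Icc_self hs))
      refine (hK.dist_le_mul (x, ξ s) ⟨hx, hUt⟩ (x', ξ s) ⟨hx', hUt⟩).trans ?_
      simp [Prod.dist_eq])
    (fun s hs => (hgs s hs).continuousWithinAt)
    (fun s hs => (hgs s (Ico_subset_Icc_self hs)).mono_of_mem_nhdsWithin (hIci s hs))
    (fun s hs => (hzs (hmem s (Ico_subset_Icc_self hs))).1.1.2)
    (fun s hs => (hhs s hs).continuousWithinAt)
    (fun s hs => (hhs s (Ico_subset_Icc_self hs)).mono_of_mem_nhdsWithin (hIci s hs))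
    (fun s hs => (hzs (hmem s (Ico_subset_Icc_self hs))).1.2.2)
    (by simp)
  have hy'mem : y' ∈ Icc t y' := right_mem_Icc.2 hty'.le
  have hinj := (extChartAt I (1 : G)).injOn (hzs (hmem y' hy'mem)).1.1.1
    (hzs (hmem y' hy'mem)).1.2.1 (key hy'mem)
  refine ⟨y', ?_, hty', min_le_right _ _⟩
  rw [htt] at hinj
  exact mul_right_cancel hinj

/-- Every continuous path in the Lie algebra of a Lie group can be integrated. -/
theorem exists_hasRightLogDerivWithinAt {ξ : ℝ → E} (hξ : ContinuousOn ξ (Icc 0 1)) :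
    ∃ g : ℝ → G, g 0 = 1 ∧
      ∀ t ∈ Icc (0 : ℝ) 1, HasRightLogDerivWithinAt I g (ξ t) (Icc 0 1) t := by
  obtain ⟨U, hU⟩ := isCompact_Icc.exists_bound_of_continuousOn hξ
  obtain ⟨R, r, τ, hR, hr, hτ, hRT, hex⟩ := exists_uniform_solution (chartRightInvariant I G)
    (isOpen_extChartAt_target 1) contDiffOn_chartRightInvariant
    (mem_extChartAt_target (I := I) (1 : G)) U
  have step : ∀ n : ℕ, ∃ g : ℝ → G, g 0 = 1 ∧ ∀ t ∈ Icc (0 : ℝ) (min 1 (n * τ)),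
      HasRightLogDerivWithinAt I g (ξ t) (Icc 0 (min 1 (n * τ))) t := by
    have hlocal : ∀ t₀ t₁ : ℝ, 0 ≤ t₀ → t₀ ≤ t₁ → t₁ ≤ 1 → t₁ - t₀ ≤ τ → ∀ c : G,
        ∃ h : ℝ → G, h t₀ = c ∧
          ∀ t ∈ Icc t₀ t₁, HasRightLogDerivWithinAt I h (ξ t) (Icc t₀ t₁) t := by
      intro t₀ t₁ h0 h01 h1 hτ' c
      have hsub : Icc t₀ t₁ ⊆ Icc 0 1 := Icc_subset_Icc h0 h1
      obtain ⟨α, hα0, hα⟩ := hex t₀ t₁ ξ h01 hτ' (hξ.mono hsub) (fun t ht => hU t (hsub ht)) _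
        (mem_closedBall_self hr.le)
      refine ⟨fun t => (extChartAt I (1 : G)).symm (α t) * c, ?_, fun t ht => ?_⟩
      · simp [hα0]
      · exact (hasRightLogDerivWithinAt_of_chart (hα t ht).2
          (hRT (closedBall_subset_closedBall (by linarith) (hα t ht).1))).mul_const c
    intro n
    induction n with
    | zero =>
      obtain ⟨h, hh0, hh⟩ := hlocal 0 0 le_rfl le_rfl zero_le_one (by simpa using hτ.le) 1
      refine ⟨h, hh0, ?_⟩
      have : min (1 : ℝ) (((0 : ℕ) : ℝ) * τ) = 0 := by simp
      rw [this]
      exact hh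
    | succ n ih =>
      obtain ⟨g, hg0, hg⟩ := ih
      have hle : min 1 (n * τ) ≤ min 1 ((n + 1 : ℕ) * τ) := by
        push_cast
        gcongr
        linarith
      have hpos : 0 ≤ min 1 (n * τ) := by positivity
      have hlen : min 1 ((n + 1 : ℕ) * τ) - min 1 (n * τ) ≤ τ := by
        push_cast
        rcases le_total 1 (n * τ) with h | h
        · rw [min_eq_left h]
          linarith [min_le_left 1 ((n + 1) * τ)]
        · rw [min_eq_right h]
          linarith [min_le_right 1 ((n + 1) * τ)]
      obtain ⟨h, hh0, hh⟩ := hlocal _ _ hpos hle (min_le_left _ _) hlen (g (min 1 (n * τ)))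
      obtain ⟨k, hk0, hk⟩ := exists_hasRightLogDerivWithinAt_glue hpos hle hg hh hh0.symm
      exact ⟨k, hk0.trans hg0, hk⟩
  obtain ⟨n, hn⟩ := exists_nat_ge (1 / τ)
  obtain ⟨g, hg0, hg⟩ := step n
  rw [min_eq_left ((div_le_iff₀ hτ).1 hn)] at hg
  exact ⟨g, hg0, hg⟩

end RightLogDeriv

section HomotopyInvariance

open Set Metric Filter Topology NNReal

variable {E H : Type*} [NormedAddCommGroup E] [NormedSpace ℝ E] [TopologicalSpace H]
  {I : ModelWithCorners ℝ E H} {G : Type*} [TopologicalSpace G] [ChartedSpace H G] [Group G]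

theorem hasRightLogDerivWithinAt_const (c : G) (s : Set ℝ) (t : ℝ) :
    HasRightLogDerivWithinAt I (fun _ => c) 0 s t := by
  refine (hasMFDerivWithinAt_const (I := 𝓘(ℝ, ℝ)) (I' := I) c s t).congr_mfderiv ?_
  have h : rightInvariantVectorField (0 : GroupLieAlgebra I G) c = 0 :=
    map_zero (mfderiv I I (fun x : G => x * c) 1)
  refine Eq.trans ?_ (congrArg (fun w : E => ContinuousLinearMap.toSpanSingleton ℝ w) h).symm
  exact (ContinuousLinearMap.toSpanSingleton_zero ℝ).symm

theorem IsDevelopment.hasRightLogDerivWithinAt {ξ : unitInterval → E} {g : unitInterval → G}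
    (hg : IsDevelopment (J := I) (G := G) ξ g) {t : ℝ} (ht : t ∈ Icc (0 : ℝ) 1) :
    HasRightLogDerivWithinAt I (fun t => g (projIcc 0 1 zero_le_one t))
      (ξ (projIcc 0 1 zero_le_one t)) (Icc 0 1) t := by
  lift t to unitInterval using ht
  have hd : MDifferentiableWithinAt 𝓘(ℝ, ℝ) I (g ∘ projIcc 0 1 zero_le_one) (Icc 0 1) (t : ℝ) :=
    (contMDiffOn_comp_projIcc_iff.2 hg.1).mdifferentiableOn (by simp) t t.2
  refine hd.hasMFDerivWithinAt.congr_mfderiv ?_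
  have h1 := (mfderivWithin_comp_projIcc_one (I := I) (f := g) (w := t)).trans (hg.2.2 t)
  have h2 : ∀ s : unitInterval, s = t →
      (mfderivWithin 𝓘(ℝ, ℝ) I (g ∘ projIcc 0 1 zero_le_one) (Icc 0 1) (t : ℝ) (1 : ℝ) : E) =
      rightInvariantVectorField (I := I) (G := G) (ξ s) (g s) := by
    rintro _ rfl; exact h1
  have h3 : ∀ (L : ℝ →L[ℝ] E) (w : E), L 1 = w →
      L = ContinuousLinearMap.toSpanSingleton ℝ w := by
    rintro L _ rfl; ext; simp
  exact h3 _ _ (h2 _ (projIcc_val zero_le_one t))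

variable [I.Boundaryless] [LieGroup I ∞ G] [FiniteDimensional ℝ E] [T2Space G]

/-- If `v dε + u dt` is a flat one-form on the unit square that vanishes along the edge `t = 0`,
then the developments `g ε` of the paths `u (ε, ·)` satisfy `(∂g/∂ε) g⁻¹ = v`. -/
theorem hasRightLogDerivWithinAt_parameter {u v : ℝ × ℝ → E}
    (hu : ContDiffOn ℝ ∞ u unitSquare) (hv : ContDiffOn ℝ ∞ v unitSquare)
    (hflat : FlatOnSquare (fun x y : E => rightBracket (I := I) (G := G) x y) u v)
    {g : ℝ → ℝ → G} (hg0 : ∀ ε ∈ Icc (0 : ℝ) 1, g ε 0 = 1)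
    (hg : ∀ ε ∈ Icc (0 : ℝ) 1, ∀ t ∈ Icc (0 : ℝ) 1,
      HasRightLogDerivWithinAt I (g ε) (u (ε, t)) (Icc 0 1) t)
    (hv0 : ∀ ε ∈ Icc (0 : ℝ) 1, v (ε, 0) = 0) {ε₀ : ℝ} (hε₀ : ε₀ ∈ Icc (0 : ℝ) 1) :
    HasRightLogDerivWithinAt I (fun ε => g ε 1) (v (ε₀, 1)) (Icc 0 1) ε₀ := by
  obtain ⟨U, hU⟩ := isCompact_unitSquare.exists_bound_of_continuousOn hu.continuousOn
  obtain ⟨R, r, τ, hR, hr, hτ, hRT, hex⟩ := exists_uniform_solution (chartRightInvariant I G)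
    (isOpen_extChartAt_target 1) contDiffOn_chartRightInvariant
    (mem_extChartAt_target (I := I) (1 : G)) U
  have hRT' : closedBall (extChartAt I (1 : G) 1) R ⊆ (extChartAt I (1 : G)).target :=
    (closedBall_subset_closedBall (by linarith)).trans hRT
  have step : ∀ t₀ t₁ : ℝ, 0 ≤ t₀ → t₀ ≤ t₁ → t₁ ≤ 1 → t₁ - t₀ ≤ τ →
      HasRightLogDerivWithinAt I (fun ε => g ε t₀) (v (ε₀, t₀)) (Icc 0 1) ε₀ →
      HasRightLogDerivWithinAt I (fun ε => g ε t₁) (v (ε₀, t₁)) (Icc 0 1) ε₀ := by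
    intro t₀ t₁ h0 h01 h1 hτ' hP
    have hsub : Icc t₀ t₁ ⊆ Icc 0 1 := Icc_subset_Icc h0 h1
    set c := (g ε₀ t₀)⁻¹ with hc
    have hsol : ∀ ε, ε ∈ Icc (0 : ℝ) 1 → extChartAt I (1 : G) (g ε t₀ * c) ∈
        closedBall (extChartAt I (1 : G) 1) r → ∃ α : ℝ → E,
          α t₀ = extChartAt I (1 : G) (g ε t₀ * c) ∧
          ∀ t ∈ Icc t₀ t₁, α t ∈ closedBall (extChartAt I (1 : G) 1) R ∧
            HasDerivWithinAt α (chartRightInvariant I G (α t) (u (ε, t))) (Icc t₀ t₁) t :=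
      fun ε hε hmem => hex t₀ t₁ (fun t => u (ε, t)) h01 hτ'
        (hu.continuousOn.comp (by fun_prop) fun t ht => ⟨hε, hsub ht⟩)
        (fun t ht => hU _ ⟨hε, hsub ht⟩) _ hmem
    choose! α hα0 hα using hsol
    have hev := eventually_mem_chart (I := I) hP.continuousWithinAt hr
    have hsource : g ε₀ t₀ * c ∈ (extChartAt I (1 : G)).source :=
      (hev.self_of_nhdsWithin hε₀).1
    have hα0' : (fun ε => α ε t₀) =ᶠ[𝓝[Icc 0 1] ε₀]
        fun ε => extChartAt I (1 : G) (g ε t₀ * c) := by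
      filter_upwards [hev, self_mem_nhdsWithin] with ε h hε
      exact hα0 ε hε h.2
    have hder : HasDerivWithinAt (fun ε => α ε t₀)
        (chartRightInvariant I G (α ε₀ t₀) (v (ε₀, t₀))) (Icc 0 1) ε₀ := by
      have h2 : α ε₀ t₀ = extChartAt I (1 : G) (g ε₀ t₀ * c) := hα0'.self_of_nhdsWithin hε₀
      rw [h2]
      exact ((hP.mul_const c).hasDerivWithinAt_chart hsource).congr_of_eventuallyEq hα0' h2
    have key := hasDerivWithinAt_parameter (isOpen_extChartAt_target 1)
      contDiffOn_chartRightInvariant maurerCartanOn_chartRightInvariant hu hv hflat hR hRT hε₀ h01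
      hsub (x := α) (by
        filter_upwards [hev, self_mem_nhdsWithin] with ε h hε
        exact hα ε hε h.2) hder
    have hg1 : (fun ε => g ε t₁) =ᶠ[𝓝[Icc 0 1] ε₀]
        fun ε => (extChartAt I (1 : G)).symm (α ε t₁) * c⁻¹ := by
      filter_upwards [hev, self_mem_nhdsWithin] with ε h hε
      have huniq := eqOn_of_hasRightLogDerivWithinAt (I := I) (ξ := fun t => u (ε, t))
        (g := fun t => g ε t * c) (h := fun t => (extChartAt I (1 : G)).symm (α ε t))
        (hu.continuousOn.comp (by fun_prop) fun t ht => ⟨hε, hsub ht⟩)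
        (fun t ht => ((hg ε hε t (hsub ht)).mono hsub).mul_const c)
        (fun t ht => hasRightLogDerivWithinAt_of_chart (hα ε hε h.2 t ht).2
          (hRT' (hα ε hε h.2 t ht).1))
        (by simp only [hα0 ε hε h.2]; exact ((extChartAt I (1 : G)).left_inv h.1).symm)
        (right_mem_Icc.2 h01)
      exact eq_mul_inv_of_mul_eq huniq
    have hmem1 := (hα ε₀ hε₀ (hev.self_of_nhdsWithin hε₀).2 t₁ (right_mem_Icc.2 h01)).1
    exact ((hasRightLogDerivWithinAt_of_chart key (hRT' hmem1)).mul_const c⁻¹).congr_of_eventuallyEq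
      hg1 (hg1.self_of_nhdsWithin hε₀)
  have hind : ∀ n : ℕ, HasRightLogDerivWithinAt I (fun ε => g ε (min 1 (n * τ)))
      (v (ε₀, min 1 (n * τ))) (Icc 0 1) ε₀ := by
    intro n
    induction n with
    | zero =>
      have : min (1 : ℝ) (((0 : ℕ) : ℝ) * τ) = 0 := by simp
      rw [this, hv0 ε₀ hε₀]
      exact (hasRightLogDerivWithinAt_const (1 : G) _ _).congr hg0 (hg0 ε₀ hε₀)
    | succ n ih =>
      refine step _ _ (by positivity) ?_ (min_le_left _ _) ?_ ih
      · push_cast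
        gcongr
        linarith
      · push_cast
        rcases le_total 1 (n * τ) with h | h
        · rw [min_eq_left h]
          linarith [min_le_left 1 ((n + 1) * τ)]
        · rw [min_eq_right h]
          linarith [min_le_right 1 ((n + 1) * τ)]
  obtain ⟨n, hn⟩ := exists_nat_ge (1 / τ)
  have := hind n
  rwa [min_eq_left ((div_le_iff₀ hτ).1 hn)] at this

/-- The end points of the developments of the paths `u (0, ·)` and `u (1, ·)` agree if
`v dε + u dt` is a flat one-form on the unit square that vanishes along the edges `t = 0` and
`t = 1`. -/
theorem development_endpoint_eq_of_flat {u v : ℝ × ℝ → E}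
    (hu : ContDiffOn ℝ ∞ u unitSquare) (hv : ContDiffOn ℝ ∞ v unitSquare)
    (hflat : FlatOnSquare (fun x y : E => rightBracket (I := I) (G := G) x y) u v)
    (hv0 : ∀ ε ∈ Icc (0 : ℝ) 1, v (ε, 0) = 0) (hv1 : ∀ ε ∈ Icc (0 : ℝ) 1, v (ε, 1) = 0)
    {g₀ g₁ : ℝ → G} (h₀ : g₀ 0 = 1) (h₁ : g₁ 0 = 1)
    (hg₀ : ∀ t ∈ Icc (0 : ℝ) 1, HasRightLogDerivWithinAt I g₀ (u (0, t)) (Icc 0 1) t)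
    (hg₁ : ∀ t ∈ Icc (0 : ℝ) 1, HasRightLogDerivWithinAt I g₁ (u (1, t)) (Icc 0 1) t) :
    g₀ 1 = g₁ 1 := by
  have hslice : ∀ ε ∈ Icc (0 : ℝ) 1, ContinuousOn (fun t => u (ε, t)) (Icc 0 1) := fun ε hε =>
    hu.continuousOn.comp (by fun_prop) fun t ht => ⟨hε, ht⟩
  have hex : ∀ ε ∈ Icc (0 : ℝ) 1, ∃ g : ℝ → G, g 0 = 1 ∧
      ∀ t ∈ Icc (0 : ℝ) 1, HasRightLogDerivWithinAt I g (u (ε, t)) (Icc 0 1) t := fun ε hε =>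
    exists_hasRightLogDerivWithinAt (hslice ε hε)
  choose! g hg0 hg using hex
  have hend : ∀ ε ∈ Icc (0 : ℝ) 1,
      HasRightLogDerivWithinAt I (fun ε => g ε 1) (0 : E) (Icc 0 1) ε := fun ε hε => by
    rw [← hv1 ε hε]
    exact hasRightLogDerivWithinAt_parameter hu hv hflat hg0 hg hv0 hε
  have hconst := eqOn_of_hasRightLogDerivWithinAt (I := I) (ξ := fun _ => (0 : E))
    continuousOn_const hend (fun t _ => hasRightLogDerivWithinAt_const (g 0 1) _ t) rfl
    (right_mem_Icc.2 zero_le_one)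
  have e₀ := eqOn_of_hasRightLogDerivWithinAt (hslice 0 (by simp)) hg₀ (hg 0 (by simp))
    (h₀.trans (hg0 0 (by simp)).symm) (right_mem_Icc.2 zero_le_one)
  have e₁ := eqOn_of_hasRightLogDerivWithinAt (hslice 1 (by simp)) hg₁ (hg 1 (by simp))
    (h₁.trans (hg0 1 (by simp)).symm) (right_mem_Icc.2 zero_le_one)
  rw [e₀, e₁]
  exact hconst.symm

theorem existsUnique_isDevelopment {ξ : unitInterval → E}
    (hξ : ContMDiff (𝓡∂ 1) 𝓘(ℝ, E) ∞ ξ) :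
    ∃! g : unitInterval → G, IsDevelopment (J := I) (G := G) ξ g := by
  have hξ' : ContDiffOn ℝ ∞ (fun t => ξ (projIcc 0 1 zero_le_one t)) (Icc 0 1) :=
    contMDiffOn_iff_contDiffOn.1 (contMDiffOn_comp_projIcc_iff.2 hξ)
  obtain ⟨g, hg0, hg⟩ := exists_hasRightLogDerivWithinAt (I := I) (G := G) hξ'.continuousOn
  have hcongr : ∀ t ∈ Icc (0 : ℝ) 1, ((fun t : unitInterval => g t) ∘ projIcc 0 1 zero_le_one) t =
      g t := fun t ht => by simp [projIcc_of_mem zero_le_one ht]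
  refine ⟨fun t => g t, ⟨?_, hg0, fun t => ?_⟩, fun h hh => ?_⟩
  · exact contMDiffOn_comp_projIcc_iff.1
      ((contMDiffOn_of_hasRightLogDerivWithinAt hξ' hg).congr hcongr)
  · rw [← mfderivWithin_comp_projIcc_one]
    have h1 := (hg t t.2).congr hcongr (hcongr t t.2)
    have h2 := h1.mfderivWithin ((uniqueDiffOn_Icc zero_lt_one _ t.2).uniqueMDiffWithinAt)
    have h3 : ∀ s : unitInterval, s = t → ((ContinuousLinearMap.toSpanSingleton ℝ
        (rightInvariantVectorField (I := I) (G := G) (ξ s) (g s) : E)) (1 : ℝ) : E) =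
        rightInvariantVectorField (I := I) (G := G) (ξ t) (g t) := by
      rintro _ rfl; simp
    exact (DFunLike.congr_fun h2 (1 : ℝ)).trans (h3 _ (projIcc_val zero_le_one t))
  · have huniq := eqOn_of_hasRightLogDerivWithinAt hξ'.continuousOn
      (fun t ht => hh.hasRightLogDerivWithinAt ht) hg
      (by simpa [hg0] using hh.2.1)
    ext t
    simpa using huniq t.2

end HomotopyInvariance

section SquareManifold

open Set Filter Topology

theorem contMDiff_oneTangentSpaceIcc : ContMDiff (𝓡∂ 1) (𝓡∂ 1).tangent ∞
    (fun z : unitInterval => (⟨z, 1⟩ : TangentBundle (𝓡∂ 1) unitInterval)) := by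
  have h1 : ContMDiff 𝓘(ℝ, ℝ) 𝓘(ℝ, ℝ).tangent ∞
      (fun z : ℝ => (⟨z, (1 : ℝ)⟩ : TangentBundle 𝓘(ℝ, ℝ) ℝ)) :=
    contMDiff_vectorSpace_iff_contDiff.2 contDiff_const
  have h2 := (contMDiffOn_projIcc (x := 0) (y := 1) (n := ∞)).contMDiffOn_tangentMapWithin
    (m := ∞) le_rfl (uniqueDiffOn_Icc zero_lt_one).uniqueMDiffOn
  have h3 := h2.comp_contMDiff (h1.comp (contMDiff_subtypeVal_Icc (x := 0) (y := 1)))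
    fun z => z.2
  refine h3.congr fun z => ?_
  have h4 : tangentMapWithin 𝓘(ℝ, ℝ) (𝓡∂ 1) (projIcc (0 : ℝ) 1 zero_le_one) (Icc 0 1)
      ⟨(z : ℝ), (1 : ℝ)⟩ = ⟨projIcc (0 : ℝ) 1 zero_le_one z, 1⟩ :=
    congrArg (fun w => (⟨projIcc (0 : ℝ) 1 zero_le_one z, w⟩ : TangentBundle (𝓡∂ 1) unitInterval))
      (mfderivWithin_projIcc_one z.2)
  refine Eq.trans ?_ h4.symm
  rw [projIcc_val]

theorem squareDt_eq (p : unitInterval × unitInterval) : squareDt p.1 p.2 =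
    (equivTangentBundleProd (𝓡∂ 1) unitInterval (𝓡∂ 1) unitInterval).symm
      (⟨p.1, 0⟩, ⟨p.2, 1⟩) := by
  simp only [squareDt, tangentMap, mfderiv_prod_right]
  rfl

theorem squareDeps_eq (p : unitInterval × unitInterval) : squareDeps p.1 p.2 =
    (equivTangentBundleProd (𝓡∂ 1) unitInterval (𝓡∂ 1) unitInterval).symm
      (⟨p.1, 1⟩, ⟨p.2, 0⟩) := by
  simp only [squareDeps, tangentMap, mfderiv_prod_left]
  rfl

/-- The coordinate vector field `∂/∂t` on the unit square. -/
def squareDtField : Cₛ^∞⟮(𝓡∂ 1).prod (𝓡∂ 1); EuclideanSpace ℝ (Fin 1) × EuclideanSpace ℝ (Fin 1),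
    (TangentSpace ((𝓡∂ 1).prod (𝓡∂ 1)) : unitInterval × unitInterval → Type _)⟯ where
  toFun p := (squareDt p.1 p.2).snd
  contMDiff_toFun := by
    have h1 : ContMDiff ((𝓡∂ 1).prod (𝓡∂ 1)) (𝓡∂ 1).tangent ∞
        (fun p : unitInterval × unitInterval =>
          (⟨p.1, 0⟩ : TangentBundle (𝓡∂ 1) unitInterval)) :=
      (contMDiff_zeroSection ℝ (TangentSpace (𝓡∂ 1) : unitInterval → Type _)).comp contMDiff_fst
    have h2 : ContMDiff ((𝓡∂ 1).prod (𝓡∂ 1)) ((𝓡∂ 1).prod (𝓡∂ 1)).tangent ∞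
        (fun p : unitInterval × unitInterval => squareDt p.1 p.2) := by
      simp_rw [squareDt_eq]
      exact contMDiff_equivTangentBundleProd_symm.comp
        (h1.prodMk (contMDiff_oneTangentSpaceIcc.comp contMDiff_snd))
    exact h2

/-- The coordinate vector field `∂/∂ε` on the unit square. -/
def squareDepsField : Cₛ^∞⟮(𝓡∂ 1).prod (𝓡∂ 1);
    EuclideanSpace ℝ (Fin 1) × EuclideanSpace ℝ (Fin 1),
    (TangentSpace ((𝓡∂ 1).prod (𝓡∂ 1)) : unitInterval × unitInterval → Type _)⟯ where
  toFun p := (squareDeps p.1 p.2).snd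
  contMDiff_toFun := by
    have h1 : ContMDiff ((𝓡∂ 1).prod (𝓡∂ 1)) (𝓡∂ 1).tangent ∞
        (fun p : unitInterval × unitInterval =>
          (⟨p.2, 0⟩ : TangentBundle (𝓡∂ 1) unitInterval)) :=
      (contMDiff_zeroSection ℝ (TangentSpace (𝓡∂ 1) : unitInterval → Type _)).comp contMDiff_snd
    have h2 : ContMDiff ((𝓡∂ 1).prod (𝓡∂ 1)) ((𝓡∂ 1).prod (𝓡∂ 1)).tangent ∞
        (fun p : unitInterval × unitInterval => squareDeps p.1 p.2) := by
      simp_rw [squareDeps_eq]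
      exact contMDiff_equivTangentBundleProd_symm.comp
        ((contMDiff_oneTangentSpaceIcc.comp contMDiff_fst).prodMk h1)
    exact h2

/-- The inclusion of the unit square into the plane. -/
def squareVal (p : unitInterval × unitInterval) : ℝ × ℝ := (p.1, p.2)

theorem squareVal_mem (p : unitInterval × unitInterval) : squareVal p ∈ unitSquare :=
  ⟨p.1.2, p.2.2⟩

theorem contMDiff_squareVal :
    ContMDiff ((𝓡∂ 1).prod (𝓡∂ 1)) 𝓘(ℝ, ℝ × ℝ) ∞ squareVal :=
  (contMDiff_subtypeVal_Icc.comp contMDiff_fst).prodMk_space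
    (contMDiff_subtypeVal_Icc.comp contMDiff_snd)

theorem mdifferentiableAt_squareVal (p : unitInterval × unitInterval) :
    MDifferentiableAt ((𝓡∂ 1).prod (𝓡∂ 1)) 𝓘(ℝ, ℝ × ℝ) squareVal p :=
  contMDiff_squareVal.mdifferentiable (by simp) p

theorem mfderiv_squareVal_squareDt (p : unitInterval × unitInterval) :
    (mfderiv ((𝓡∂ 1).prod (𝓡∂ 1)) 𝓘(ℝ, ℝ × ℝ) squareVal p (squareDtField p) : ℝ × ℝ) =
      (0, 1) := by
  have hd : MDifferentiableAt (𝓡∂ 1) ((𝓡∂ 1).prod (𝓡∂ 1))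
      (fun s : unitInterval => (p.1, s)) p.2 := mdifferentiableAt_const.prodMk mdifferentiableAt_id
  have hv : MDifferentiableAt (𝓡∂ 1) 𝓘(ℝ, ℝ) (fun s : unitInterval => (s : ℝ)) p.2 :=
    (contMDiff_subtypeVal_Icc (n := ∞)).mdifferentiable (by simp) p.2
  have h1 := (mdifferentiableAt_squareVal p).hasMFDerivAt.comp p.2 hd.hasMFDerivAt
  have h2 : HasMFDerivAt (𝓡∂ 1) 𝓘(ℝ, ℝ × ℝ) (squareVal ∘ fun s : unitInterval => (p.1, s)) p.2
      ((0 : TangentSpace (𝓡∂ 1) p.2 →L[ℝ] ℝ).prod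
        (mfderiv (𝓡∂ 1) 𝓘(ℝ, ℝ) (fun s : unitInterval => (s : ℝ)) p.2)) := by
    rw [modelWithCornersSelf_prod, ← chartedSpaceSelf_prod]
    exact (hasMFDerivAt_const _ _).prodMk hv.hasMFDerivAt
  have h3 := DFunLike.congr_fun (hasMFDerivAt_unique h1 h2) (1 : TangentSpace (𝓡∂ 1) p.2)
  refine Eq.trans h3 ?_
  exact Prod.ext rfl (mfderiv_subtypeVal_Icc_one p.2)

theorem mfderiv_squareVal_squareDeps (p : unitInterval × unitInterval) :
    (mfderiv ((𝓡∂ 1).prod (𝓡∂ 1)) 𝓘(ℝ, ℝ × ℝ) squareVal p (squareDepsField p) : ℝ × ℝ) =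
      (1, 0) := by
  have hd : MDifferentiableAt (𝓡∂ 1) ((𝓡∂ 1).prod (𝓡∂ 1))
      (fun s : unitInterval => (s, p.2)) p.1 := mdifferentiableAt_id.prodMk mdifferentiableAt_const
  have hv : MDifferentiableAt (𝓡∂ 1) 𝓘(ℝ, ℝ) (fun s : unitInterval => (s : ℝ)) p.1 :=
    (contMDiff_subtypeVal_Icc (n := ∞)).mdifferentiable (by simp) p.1
  have h1 := (mdifferentiableAt_squareVal p).hasMFDerivAt.comp p.1 hd.hasMFDerivAt
  have h2 : HasMFDerivAt (𝓡∂ 1) 𝓘(ℝ, ℝ × ℝ) (squareVal ∘ fun s : unitInterval => (s, p.2)) p.1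
      ((mfderiv (𝓡∂ 1) 𝓘(ℝ, ℝ) (fun s : unitInterval => (s : ℝ)) p.1).prod
        (0 : TangentSpace (𝓡∂ 1) p.1 →L[ℝ] ℝ)) := by
    rw [modelWithCornersSelf_prod, ← chartedSpaceSelf_prod]
    exact hv.hasMFDerivAt.prodMk (hasMFDerivAt_const _ _)
  have h3 := DFunLike.congr_fun (hasMFDerivAt_unique h1 h2) (1 : TangentSpace (𝓡∂ 1) p.1)
  refine Eq.trans h3 ?_
  exact Prod.ext (mfderiv_subtypeVal_Icc_one p.1) rfl

theorem isInvertible_of_surjective_of_finrank_eq {V W : Type*} [NormedAddCommGroup V]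
    [NormedSpace ℝ V] [FiniteDimensional ℝ V] [NormedAddCommGroup W] [NormedSpace ℝ W]
    [FiniteDimensional ℝ W] (L : V →L[ℝ] W) (hL : Function.Surjective L)
    (h : Module.finrank ℝ V = Module.finrank ℝ W) : L.IsInvertible := by
  have hinj := (LinearMap.injective_iff_surjective_of_finrank_eq_finrank (f := L.toLinearMap) h).2 hL
  refine ⟨(LinearEquiv.ofBijective L.toLinearMap ⟨hinj, hL⟩).toContinuousLinearEquiv, ?_⟩
  ext; rfl

theorem isInvertible_mfderiv_squareVal (p : unitInterval × unitInterval) :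
    (mfderiv ((𝓡∂ 1).prod (𝓡∂ 1)) 𝓘(ℝ, ℝ × ℝ) squareVal p).IsInvertible := by
  refine isInvertible_of_surjective_of_finrank_eq
    (V := EuclideanSpace ℝ (Fin 1) × EuclideanSpace ℝ (Fin 1)) (W := ℝ × ℝ) _ (fun w => ?_)
    (by simp)
  refine ⟨w.1 • (squareDepsField p : EuclideanSpace ℝ (Fin 1) × EuclideanSpace ℝ (Fin 1)) +
    w.2 • (squareDtField p : EuclideanSpace ℝ (Fin 1) × EuclideanSpace ℝ (Fin 1)), ?_⟩
  refine (map_add (mfderiv ((𝓡∂ 1).prod (𝓡∂ 1)) 𝓘(ℝ, ℝ × ℝ) squareVal p) _ _).trans ?_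
  have h1 := map_smul (mfderiv ((𝓡∂ 1).prod (𝓡∂ 1)) 𝓘(ℝ, ℝ × ℝ) squareVal p) w.1
    (squareDepsField p)
  have h2 := map_smul (mfderiv ((𝓡∂ 1).prod (𝓡∂ 1)) 𝓘(ℝ, ℝ × ℝ) squareVal p) w.2
    (squareDtField p)
  refine (congrArg₂ (fun a b : ℝ × ℝ => a + b) h1 h2).trans ?_
  refine (congrArg₂ (fun a b : ℝ × ℝ => w.1 • a + w.2 • b) (mfderiv_squareVal_squareDeps p)
    (mfderiv_squareVal_squareDt p)).trans ?_
  ext <;> simp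

theorem lieBracket_const {V : Type*} [NormedAddCommGroup V] [NormedSpace ℝ V] (v w x : V) :
    lieBracket ℝ (fun _ => v) (fun _ => w) x = 0 := by
  simp [lieBracket]

theorem mlieBracket_squareDtField_squareDepsField (p : unitInterval × unitInterval) :
    mlieBracket ((𝓡∂ 1).prod (𝓡∂ 1)) squareDtField squareDepsField p = 0 := by
  have hpull : ∀ (X : Π q : unitInterval × unitInterval, TangentSpace ((𝓡∂ 1).prod (𝓡∂ 1)) q)
      (w : ℝ × ℝ), (∀ q, (mfderiv ((𝓡∂ 1).prod (𝓡∂ 1)) 𝓘(ℝ, ℝ × ℝ) squareVal q (X q) : ℝ × ℝ) = w) →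
      X = mpullback ((𝓡∂ 1).prod (𝓡∂ 1)) 𝓘(ℝ, ℝ × ℝ) squareVal fun _ => w := by
    intro X w hX
    ext1 q
    exact ((isInvertible_mfderiv_squareVal q).inverse_apply_eq.2 (hX q).symm).symm
  have hmd : ∀ (w x : ℝ × ℝ), MDifferentiableAt 𝓘(ℝ, ℝ × ℝ) 𝓘(ℝ, ℝ × ℝ).tangent
      (fun y : ℝ × ℝ => (⟨y, w⟩ : TangentBundle 𝓘(ℝ, ℝ × ℝ) (ℝ × ℝ))) x := fun w x =>
    ((contMDiff_vectorSpace_iff_contDiff (V := fun _ : ℝ × ℝ => w) (n := ∞)).2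
      contDiff_const).mdifferentiable (by simp) x
  have hM : IsManifold ((𝓡∂ 1).prod (𝓡∂ 1)) (minSmoothness ℝ 3) (unitInterval × unitInterval) := by
    simp only [minSmoothness_of_isRCLikeNormedField]; infer_instance
  have key := mpullback_mlieBracket (n := ∞) (I := (𝓡∂ 1).prod (𝓡∂ 1)) (I' := 𝓘(ℝ, ℝ × ℝ))
    (f := squareVal) (x₀ := p) (V := fun _ => ((0, 1) : ℝ × ℝ)) (W := fun _ => ((1, 0) : ℝ × ℝ))
    (hmd _ _) (hmd _ _) contMDiff_squareVal.contMDiffAt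
    (by rw [minSmoothness_of_isRCLikeNormedField]; exact ENat.LEInfty.out)
  rw [← hpull _ _ mfderiv_squareVal_squareDt, ← hpull _ _ mfderiv_squareVal_squareDeps] at key
  have h0 : mlieBracket 𝓘(ℝ, ℝ × ℝ) (fun _ => ((0, 1) : ℝ × ℝ)) (fun _ => ((1, 0) : ℝ × ℝ))
      (squareVal p) = 0 :=
    (mlieBracket_eq_lieBracket _ _ _).trans (lieBracket_const (V := ℝ × ℝ) _ _ _)
  exact key.symm.trans ((congrArg (mfderiv ((𝓡∂ 1).prod (𝓡∂ 1)) 𝓘(ℝ, ℝ × ℝ) squareVal p).inverse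
    h0).trans (map_zero _))

theorem mvfderiv_comp_squareVal {f : ℝ × ℝ → ℝ} {p : unitInterval × unitInterval}
    (hf : DifferentiableWithinAt ℝ f unitSquare (squareVal p))
    (X : TangentSpace ((𝓡∂ 1).prod (𝓡∂ 1)) p) {w : ℝ × ℝ}
    (hX : (mfderiv ((𝓡∂ 1).prod (𝓡∂ 1)) 𝓘(ℝ, ℝ × ℝ) squareVal p X : ℝ × ℝ) = w) :
    mvfderiv ((𝓡∂ 1).prod (𝓡∂ 1)) (fun q => f (squareVal q)) p X =
      fderivWithin ℝ f unitSquare (squareVal p) w := by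
  have h1 := hasMFDerivWithinAt_univ.1 (HasMFDerivWithinAt.comp p
    hf.hasFDerivWithinAt.hasMFDerivWithinAt
    (mdifferentiableAt_squareVal p).hasMFDerivAt.hasMFDerivWithinAt fun q _ => squareVal_mem q)
  subst hX
  exact DFunLike.congr_fun h1.mfderiv X

/-- The extension of a function on the unit square to the plane, constant beyond the edges. -/
def squareExtend {E : Type*} (f : unitInterval × unitInterval → E) (x : ℝ × ℝ) : E :=
  f (projIcc 0 1 zero_le_one x.1, projIcc 0 1 zero_le_one x.2)

theorem squareExtend_squareVal {E : Type*} (f : unitInterval × unitInterval → E)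
    (p : unitInterval × unitInterval) : squareExtend f (squareVal p) = f p := by
  simp [squareExtend, squareVal]

theorem contDiffOn_squareExtend {E : Type*} [NormedAddCommGroup E] [NormedSpace ℝ E]
    {f : unitInterval × unitInterval → E}
    (hf : ContMDiff ((𝓡∂ 1).prod (𝓡∂ 1)) 𝓘(ℝ, E) ∞ f) :
    ContDiffOn ℝ ∞ (squareExtend f) unitSquare := by
  have h : ContMDiffOn (𝓘(ℝ, ℝ).prod 𝓘(ℝ, ℝ)) ((𝓡∂ 1).prod (𝓡∂ 1)) ∞ (fun x : ℝ × ℝ =>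
      (projIcc (0 : ℝ) 1 zero_le_one x.1, projIcc (0 : ℝ) 1 zero_le_one x.2)) unitSquare :=
    (contMDiffOn_projIcc.comp contMDiffOn_fst fun x hx => hx.1).prodMk
      (contMDiffOn_projIcc.comp contMDiffOn_snd fun x hx => hx.2)
  have h2 := hf.comp_contMDiffOn h
  rw [← contMDiffOn_iff_contDiffOn, modelWithCornersSelf_prod, ← chartedSpaceSelf_prod]
  exact h2

end SquareManifold

section AlgebroidMorphisms

open Set Filter Topology

theorem contMDiff_snd_trivial {E₁ H₁ B : Type*} [NormedAddCommGroup E₁] [NormedSpace ℝ E₁]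
    [TopologicalSpace H₁] (I₁ : ModelWithCorners ℝ E₁ H₁) [TopologicalSpace B] [ChartedSpace H₁ B]
    [IsManifold I₁ ∞ B]
    (E : Type*) [NormedAddCommGroup E] [NormedSpace ℝ E] :
    ContMDiff (I₁.prod 𝓘(ℝ, E)) 𝓘(ℝ, E) ∞ (fun q : TotalSpace E (Trivial B E) => (q.snd : E)) :=
  fun _ => ((contMDiffAt_totalSpace (IB := I₁)
    (f := (id : TotalSpace E (Trivial B E) → TotalSpace E (Trivial B E)))).1 contMDiffAt_id).2

theorem exists_contMDiffSection_eq {E H M F : Type*} [NormedAddCommGroup E] [NormedSpace ℝ E]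
    [FiniteDimensional ℝ E] [TopologicalSpace H] {I : ModelWithCorners ℝ E H}
    [TopologicalSpace M] [T2Space M] [ChartedSpace H M] [IsManifold I ∞ M]
    [NormedAddCommGroup F] [NormedSpace ℝ F]
    {A : M → Type*} [TopologicalSpace (TotalSpace F A)] [∀ x, TopologicalSpace (A x)]
    [∀ x, AddCommGroup (A x)] [∀ x, Module ℝ (A x)] [FiberBundle F A] [VectorBundle ℝ F A]
    [ContMDiffVectorBundle ∞ F A I] (x : M) (w : A x) :
    ∃ Y : Cₛ^∞⟮I; F, A⟯, Y x = w := by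
  obtain ⟨s, hs, hw⟩ := FiberBundle.exists_contMDiffOn_extend I F w (k := ∞)
  obtain ⟨f, -, hf⟩ := (SmoothBumpFunction.nhds_basis_tsupport (I := I) x).mem_iff.1
    (interior_mem_nhds.2 hs)
  have h := ContMDiffOn.smul_section_of_tsupport (f.contMDiff.contMDiffOn (s := interior s))
    isOpen_interior hf (hw.mono interior_subset)
  exact ⟨⟨_, h⟩, by simp⟩

variable {E H M F : Type*} [NormedAddCommGroup E] [NormedSpace ℝ E]
  [TopologicalSpace H] {I : ModelWithCorners ℝ E H}
  [TopologicalSpace M] [ChartedSpace H M] [IsManifold I ∞ M]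
  [NormedAddCommGroup F] [NormedSpace ℝ F]
  {A : M → Type*} [TopologicalSpace (TotalSpace F A)] [∀ x, TopologicalSpace (A x)]
  [∀ x, AddCommGroup (A x)] [∀ x, Module ℝ (A x)] [FiberBundle F A] [VectorBundle ℝ F A]
  [ContMDiffVectorBundle ∞ F A I]
  {𝓐 : LieAlgebroid I F A}
  {E' H' G : Type*} [NormedAddCommGroup E'] [NormedSpace ℝ E'] [FiniteDimensional ℝ E']
  [TopologicalSpace H'] {J : ModelWithCorners ℝ E' H'}
  [TopologicalSpace G] [ChartedSpace H' G] [Group G] [LieGroup J ∞ G]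
  (η : LieAlgebroidMorphism 𝓐 (lieGroupLieAlgebroid J G))

theorem contMDiff_map_snd : ContMDiff (I.prod 𝓘(ℝ, F)) 𝓘(ℝ, E') ∞
    (fun q : TotalSpace F A => ((η.map q).snd : E')) :=
  (contMDiff_snd_trivial 𝓘(ℝ, Unit) E').comp η.contMDiff_toFun

theorem contMDiff_compPath (a : APath 𝓐) :
    ContMDiff (𝓡∂ 1) 𝓘(ℝ, E') ∞ (fun t => ((η.map (a.toFun t)).snd : E')) :=
  (contMDiff_map_snd η).comp a.contMDiff_toFun

theorem d_comp_lieGroupLieAlgebroid (ℓ : E' →L[ℝ] ℝ) (x : M) (Y Y' : Cₛ^∞⟮I; F, A⟯) :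
    𝓐.d (fun y => (ℓ : E' →ₗ[ℝ] ℝ) ∘ₗ η.toFun y) Y Y' x =
      - ℓ (rightBracket (I := J) (G := G) (η.toFun x (Y x)) (η.toFun x (Y' x))) := by
  have h := η.d_comm (fun _ => (ℓ : E' →ₗ[ℝ] ℝ))
    (ℓ.contMDiff.comp (contMDiff_snd_trivial 𝓘(ℝ, Unit) E')) x Y Y'
    ⟨fun _ => η.toFun x (Y x), contMDiff_of_discreteTopology⟩
    ⟨fun _ => η.toFun x (Y' x), contMDiff_of_discreteTopology⟩ rfl rfl
  refine h.trans ?_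
  have h0 : ∀ f : Unit → ℝ, mvfderiv 𝓘(ℝ, Unit) f () ((0 : E' →ₗ[ℝ] TangentSpace 𝓘(ℝ, Unit) ())
      (0 : E')) = 0 := fun f => map_zero (mvfderiv 𝓘(ℝ, Unit) f ())
  have h1 : ∀ a b c : ℝ, a = 0 → b = 0 → a - b - c = -c := by
    rintro a b c rfl rfl
    simp
  exact h1 _ _ _ (h0 _) (h0 _)

variable (Φ : LieAlgebroidMorphism
    (tangentLieAlgebroid ((𝓡∂ 1).prod (𝓡∂ 1)) (unitInterval × unitInterval)) 𝓐)

/-- Smooth vector fields on the unit square. -/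
abbrev SquareVectorField : Type := Cₛ^∞⟮(𝓡∂ 1).prod (𝓡∂ 1);
    EuclideanSpace ℝ (Fin 1) × EuclideanSpace ℝ (Fin 1),
    (TangentSpace ((𝓡∂ 1).prod (𝓡∂ 1)) : unitInterval × unitInterval → Type _)⟯

/-- The value of `η ∘ Φ` on a vector field on the unit square. -/
def squareForm (X : Π p : unitInterval × unitInterval, TangentSpace ((𝓡∂ 1).prod (𝓡∂ 1)) p)
    (p : unitInterval × unitInterval) : E' :=
  η.toFun (Φ.base p) (Φ.toFun p (X p))

theorem contMDiff_squareForm (X : SquareVectorField) :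
    ContMDiff ((𝓡∂ 1).prod (𝓡∂ 1)) 𝓘(ℝ, E') ∞ (squareForm η Φ X) :=
  (contMDiff_map_snd η).comp (Φ.contMDiff_toFun.comp X.contMDiff)

theorem squareForm_maurerCartan [FiniteDimensional ℝ E] [T2Space M] (ℓ : E' →L[ℝ] ℝ)
    (p : unitInterval × unitInterval) :
    mvfderiv ((𝓡∂ 1).prod (𝓡∂ 1)) (fun q => ℓ (squareForm η Φ squareDepsField q)) p
        (squareDtField p) -
      mvfderiv ((𝓡∂ 1).prod (𝓡∂ 1)) (fun q => ℓ (squareForm η Φ squareDtField q)) p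
        (squareDepsField p) =
      - ℓ (rightBracket (I := J) (G := G) (squareForm (E' := E') η Φ squareDtField p)
        (squareForm (E' := E') η Φ squareDepsField p)) := by
  obtain ⟨Y, hY⟩ := exists_contMDiffSection_eq (I := I) (F := F) (A := A) (Φ.base p)
    (Φ.toFun p (squareDtField p))
  obtain ⟨Y', hY'⟩ := exists_contMDiffSection_eq (I := I) (F := F) (A := A) (Φ.base p)
    (Φ.toFun p (squareDepsField p))
  have h1 := Φ.d_comm (fun y => (ℓ : E' →ₗ[ℝ] ℝ) ∘ₗ η.toFun y)
    (ℓ.contMDiff.comp (contMDiff_map_snd η)) p squareDtField squareDepsField Y Y' hY hY'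
  rw [d_comp_lieGroupLieAlgebroid, hY, hY'] at h1
  have h2 := mlieBracket_squareDtField_squareDepsField p
  have h3 : ∀ a b c d : ℝ, a - b - c = d → c = 0 → a - b = d := by
    rintro a b c d rfl rfl
    simp
  refine h3 _ _ _ _ h1 ?_
  exact (congrArg (fun w => ℓ (η.toFun (Φ.base p) (Φ.toFun p w))) h2).trans (by simp)

theorem flatOnSquare_squareForm [FiniteDimensional ℝ E] [T2Space M] : FlatOnSquare
    (fun x y : E' => rightBracket (I := J) (G := G) x y)
    (squareExtend (squareForm η Φ squareDtField))
    (squareExtend (squareForm η Φ squareDepsField)) := by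
  intro x hx
  obtain ⟨p, rfl⟩ : ∃ p, squareVal p = x := ⟨(⟨x.1, hx.1⟩, ⟨x.2, hx.2⟩), rfl⟩
  have hdiff : ∀ X : SquareVectorField, DifferentiableWithinAt ℝ (squareExtend (squareForm η Φ ⇑X)) unitSquare
      (squareVal p) := fun X =>
    (contDiffOn_squareExtend (contMDiff_squareForm η Φ X)).differentiableOn (by simp) _ hx
  have hℓ : ∀ (ℓ : E' →L[ℝ] ℝ) (X : SquareVectorField) (Z : TangentSpace ((𝓡∂ 1).prod (𝓡∂ 1)) p) (w : ℝ × ℝ),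
      (mfderiv ((𝓡∂ 1).prod (𝓡∂ 1)) 𝓘(ℝ, ℝ × ℝ) squareVal p Z : ℝ × ℝ) = w →
      mvfderiv ((𝓡∂ 1).prod (𝓡∂ 1)) (fun q => ℓ (squareForm η Φ ⇑X q)) p Z =
        ℓ (fderivWithin ℝ (squareExtend (squareForm η Φ ⇑X)) unitSquare (squareVal p) w) := by
    intro ℓ X Z w hZ
    have h1 := mvfderiv_comp_squareVal (ℓ.differentiableAt.comp_differentiableWithinAt _ (hdiff X))
      Z hZ
    have h2 := ℓ.hasFDerivAt.comp_hasFDerivWithinAt _ (hdiff X).hasFDerivWithinAt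
    rw [h2.fderivWithin (uniqueDiffOn_unitSquare _ hx)] at h1
    simp only [Function.comp_apply, squareExtend_squareVal] at h1
    exact h1
  refine (SeparatingDual.eq_iff_forall_dual_eq (R := ℝ)).2 fun ℓ => ?_
  have h := squareForm_maurerCartan η Φ ℓ p
  rw [hℓ ℓ squareDepsField _ _ (mfderiv_squareVal_squareDt p),
    hℓ ℓ squareDtField _ _ (mfderiv_squareVal_squareDeps p)] at h
  rw [map_sub, h, squareExtend_squareVal, squareExtend_squareVal]
  exact (map_neg ℓ _).symm

theorem development_endpoint_eq_of_homotopic [FiniteDimensional ℝ E] [T2Space M] [T2Space G]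
    [J.Boundaryless] {a₀ a₁ : APath 𝓐} (h : a₀.Homotopic a₁) {g₀ g₁ : unitInterval → G}
    (h₀ : IsDevelopment (η.compPath a₀) g₀) (h₁ : IsDevelopment (η.compPath a₁) g₁) :
    g₀ 1 = g₁ 1 := by
  obtain ⟨x, y, -, -, -, -, Φ, ha₀, ha₁, hx, hy⟩ := h
  have hzero : ∀ (p : unitInterval × unitInterval) (z : M),
      Φ.map (squareDeps p.1 p.2) = ⟨z, 0⟩ → squareForm η Φ squareDepsField p = (0 : E') := by
    intro p z hz
    have h1 : (η.map (Φ.map (squareDeps p.1 p.2))).snd = (η.map ⟨z, 0⟩).snd := by rw [hz]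
    exact h1.trans (map_zero (η.toFun z))
  have hpath : ∀ (a : APath 𝓐) (ε t : unitInterval), Φ.map (squareDt ε t) = a.toFun t →
      η.compPath a t = squareForm η Φ squareDtField (ε, t) := by
    intro a ε t ht
    have h1 : (η.map (Φ.map (squareDt ε t))).snd = (η.map (a.toFun t)).snd := by rw [ht]
    exact h1.symm
  have hp0 : projIcc (0 : ℝ) 1 zero_le_one 0 = 0 := projIcc_left _
  have hp1 : projIcc (0 : ℝ) 1 zero_le_one 1 = 1 := projIcc_right _
  have key := development_endpoint_eq_of_flat (I := J) (G := G)
    (contDiffOn_squareExtend (contMDiff_squareForm η Φ squareDtField))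
    (contDiffOn_squareExtend (contMDiff_squareForm η Φ squareDepsField))
    (flatOnSquare_squareForm η Φ)
    (fun ε _ => hzero (projIcc 0 1 zero_le_one ε, projIcc 0 1 zero_le_one 0) x
      (by rw [hp0]; exact hx _))
    (fun ε _ => hzero (projIcc 0 1 zero_le_one ε, projIcc 0 1 zero_le_one 1) y
      (by rw [hp1]; exact hy _))
    (g₀ := fun t => g₀ (projIcc 0 1 zero_le_one t)) (g₁ := fun t => g₁ (projIcc 0 1 zero_le_one t))
    (by rw [hp0]; exact h₀.2.1) (by rw [hp0]; exact h₁.2.1)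
    (fun t ht => by
      have h2 := IsDevelopment.hasRightLogDerivWithinAt h₀ ht
      rw [hpath a₀ 0 _ (ha₀ _)] at h2
      simpa only [squareExtend, hp0] using h2)
    (fun t ht => by
      have h2 := IsDevelopment.hasRightLogDerivWithinAt h₁ ht
      rw [hpath a₁ 1 _ (ha₁ _)] at h2
      simpa only [squareExtend, hp1] using h2)
  simpa only [hp1] using key

end AlgebroidMorphisms
end

theorem proposition3p4
    {E H M F : Type*} [NormedAddCommGroup E] [NormedSpace ℝ E] [FiniteDimensional ℝ E]
    [TopologicalSpace H] {I : ModelWithCorners ℝ E H} [I.Boundaryless]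
    [TopologicalSpace M] [T2Space M] [ChartedSpace H M] [IsManifold I ∞ M]
    [NormedAddCommGroup F] [NormedSpace ℝ F] [FiniteDimensional ℝ F]
    {A : M → Type*} [TopologicalSpace (TotalSpace F A)] [∀ x, TopologicalSpace (A x)]
    [∀ x, AddCommGroup (A x)] [∀ x, Module ℝ (A x)] [FiberBundle F A] [VectorBundle ℝ F A]
    [ContMDiffVectorBundle ∞ F A I]
    (𝓐 : LieAlgebroid I F A)
    {E' H' G : Type*} [NormedAddCommGroup E'] [NormedSpace ℝ E'] [FiniteDimensional ℝ E']
    [TopologicalSpace H'] {J : ModelWithCorners ℝ E' H'} [J.Boundaryless]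
    [TopologicalSpace G] [T2Space G] [ChartedSpace H' G] [Group G] [LieGroup J ∞ G]
    (η : LieAlgebroidMorphism 𝓐 (lieGroupLieAlgebroid J G)) :
    (∀ a : APath 𝓐, ∃! g : unitInterval → G, IsDevelopment (η.compPath a) g) ∧
    (∀ a₀ a₁ : APath 𝓐, a₀.Homotopic a₁ → ∀ g₀ g₁ : unitInterval → G,
      IsDevelopment (η.compPath a₀) g₀ → IsDevelopment (η.compPath a₁) g₁ → g₀ 1 = g₁ 1) ∧
    (∃! Ω : WeinsteinGroupoid 𝓐 → G, ∀ (a : APath 𝓐) (g : unitInterval → G),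
      IsDevelopment (η.compPath a) g → Ω (WeinsteinGroupoid.mk a) = g 1) := by
  have hex := fun a : APath 𝓐 =>
    existsUnique_isDevelopment (I := J) (G := G) (ξ := η.compPath a) (contMDiff_compPath η a)
  have hend : ∀ a₀ a₁ : APath 𝓐, a₀.Homotopic a₁ → ∀ g₀ g₁ : unitInterval → G,
      IsDevelopment (η.compPath a₀) g₀ → IsDevelopment (η.compPath a₁) g₁ → g₀ 1 = g₁ 1 :=
    fun _ _ h _ _ h₀ h₁ => development_endpoint_eq_of_homotopic η h h₀ h₁
  refine ⟨hex, hend, ?_⟩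
  choose dev hdev huniq using fun a => hex a
  refine ⟨Quot.lift (fun a => dev a 1) fun a₀ a₁ h => hend a₀ a₁ h _ _ (hdev a₀) (hdev a₁),
    fun a g hg => ?_, fun Ω hΩ => ?_⟩
  · exact congrFun (huniq a g hg).symm 1
  · funext q
    induction q using Quot.ind with
    | mk a => exact hΩ a (dev a) (hdev a)
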